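/- Let $a,b,c,d$ be integers with $a,c\neq 0$, $\frac ba\neq\frac dc$ and $a\neq\pm c$, and let $h(x)\in\mathbb Z[x]$ be a monic cubic polynomial with $a^3h(\frac ba)\in\{1,-1\}$ and $c^3h(\frac dc)\in\{1,-1\}$. For $t\in\mathbb Z$ put $h_t(x)=h(x)+t(ax-b)(cx-d)$. 1. For all integers $t$ with $|t|$ large enough, $h_t$ is totally real (all its complex roots are real) and irreducible. For every $t$ choose a root $\theta_t$ of $h_t$ and let $K_t=\mathbb Q(\theta_t)$. For $|t|$ large, $K_t$ is a totally real cubic field; write $\sigma_1,\sigma_2,\sigma_3:K_t\to\mathbb R$ for its embeddings, in any order. Then: 2. For all $t$ with $|t|$ large enough, $a\theta_t-b$ and $c\theta_t-d$ are units of $\mathbb Z[\theta_t]$, and the unit group of $\mathbb Z[\theta_t]$ is generated by $\{a\theta_t-b,\ c\theta_t-d,\ -1\}$. 3. For $|t|$ large the unit lattice $\{(\log|\sigma_i(u)|)_{i=1}^3 : u\in\mathbb Z[\theta_t]^\times\}$ is a lattice in the plane $\mathbb R^3_0=\{x\in\mathbb R^3:\sum_i x_i=0\}$. It has a shape, namely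 the class in $\mathrm{SL}_2(\mathbb Z)\backslash\mathbb H$ of a $z\in\mathbb H$ such that a linear similarity $\mathbb C\to\mathbb R^3_0$ maps $\mathbb Z+\mathbb Zz$ onto it (if the similarity is allowed to reverse the orientation, the shape is unique up to the reflection $z\mapsto-\bar z$). As $|t|\to\infty$, and for every choice of these shapes, they converge in $\mathrm{SL}_2(\mathbb Z)\backslash\mathbb H$ to the shape of the regular triangle lattice, the class of $\omega=e^{2\pi i/3}$. 4. Let $A<\mathrm{SL}_3(\mathbb R)$ be the group of diagonal matrices with positive diagonal entries, let $X=\mathrm{SL}_3(\mathbb R)/\mathrm{SL}_3(\mathbb Z)$ be the space of unimodular lattices in $\mathbb R^3$, and let $x_t\in X$ be the lattice $\{(\sigma_i(\alpha))_{i=1}^3:\alpha\in\mathbb Z[\theta_t]\}$ rescaled to covolume $1$. For $|t|$ large the orbit $Ax_t$ is compact and carries an $A$-invariant probability measure $\mu_t$, and as $|t|\to\infty$ these orbits exhibit full escape of mass: $\mu_t$ converges weak-$*$ to the zero measure, i.e. $\int_X f\,d\mu_t\to 0$ for every continuous $f:X\to\mathbb R$ with compact support. -/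

import Mathlib

open Polynomial Filter Topology MeasureTheory

namespace CubicOrders

noncomputable section

/-- The filter "`|t| → ∞`" on the integers: its sets are those that contain
`{t | N ≤ |t|}` for some `N`. -/
def absAtTop : Filter ℤ := Filter.comap (fun t : ℤ => |t|) Filter.atTop

/-- The polynomial `h_t = h + t (a x - b) (c x - d)`. -/
def family (a b c d : ℤ) (h : ℤ[X]) (t : ℤ) : ℤ[X] :=
  h + C t * ((C a * X - C b) * (C c * X - C d))

/-- A polynomial is totally real if all its complex roots are real. -/
def IsTotallyReal (p : ℤ[X]) : Prop :=
  ∀ z : ℂ, aeval z p = 0 → z.im = 0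

/-- The order `ℤ[θ]`. -/
abbrev zAdjoin {K : Type*} [Field K] (θ : K) : Subalgebra ℤ K :=
  Algebra.adjoin ℤ {θ}

/-! ### Unit lattices and their shapes -/

/-- The logarithmic vector `ψ(α) = (log |σ₁ α|, log |σ₂ α|, log |σ₃ α|)` in Euclidean space. -/
def logVec {K : Type*} [Field K] (σ : Fin 3 → (K →+* ℝ)) (α : K) : EuclideanSpace ℝ (Fin 3) :=
  WithLp.toLp 2 fun i => Real.log |σ i α|

/-- The unit lattice `ψ(𝒪ˣ)`. -/
def unitLattice {K : Type*} [Field K] (σ : Fin 3 → (K →+* ℝ)) (O : Subalgebra ℤ K) :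
    Set (EuclideanSpace ℝ (Fin 3)) :=
  {v | ∃ u : Oˣ, v = logVec σ ((u : O) : K)}

/-- The modular surface `SL₂(ℤ) \ ℍ`, with the quotient topology. -/
abbrev ModularSurface : Type :=
  Quotient (MulAction.orbitRel (Matrix.SpecialLinearGroup (Fin 2) ℤ) UpperHalfPlane)

/-- The point of the modular surface represented by `z`. -/
def ModularSurface.mk (z : UpperHalfPlane) : ModularSurface := Quotient.mk _ z

/-- `s` is the shape of `Λ ⊆ ℝ³₀ = {x | x₁ + x₂ + x₃ = 0}`: some linear similarity `f` of `ℂ = ℝ²`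
with the plane `ℝ³₀` maps the lattice `ℤ + ℤ z` onto `Λ`, where `s` is the class of `z`.
The similarity may reverse the orientation, so that `s` is determined by `Λ` up to the
reflection `z ↦ -conj z` of the modular surface. -/
def IsShapeOfLattice (Λ : Set (EuclideanSpace ℝ (Fin 3))) (s : ModularSurface) : Prop :=
  ∃ (f : ℂ →ₗ[ℝ] EuclideanSpace ℝ (Fin 3)) (r : ℝ) (z : UpperHalfPlane),
    0 < r ∧ (∀ w : ℂ, ‖f w‖ = r * ‖w‖) ∧
    Set.range f = {x | ∑ i, x i = 0} ∧
    f '' {w : ℂ | ∃ m n : ℤ, w = m + n * (z : ℂ)} = Λ ∧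
    s = ModularSurface.mk z

/-- `s` is the shape of the unit lattice of the order `O`, for some enumeration
`σ₁, σ₂, σ₃` of the real embeddings of the field. -/
def IsUnitShape {K : Type*} [Field K] (O : Subalgebra ℤ K) (s : ModularSurface) : Prop :=
  ∃ σ : Fin 3 → (K →+* ℝ), Function.Bijective σ ∧ IsShapeOfLattice (unitLattice σ O) s

/-- The point `ω = exp(2πi/3)` of the upper half plane. -/
def omega : UpperHalfPlane :=
  ⟨Complex.exp (2 * Real.pi / 3 * Complex.I), by
    have e : (2 * Real.pi / 3 * Complex.I : ℂ) = ((2 * Real.pi / 3 : ℝ) : ℂ) * Complex.I := by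
      push_cast; ring
    rw [e, Complex.exp_ofReal_mul_I_im]
    apply Real.sin_pos_of_pos_of_lt_pi <;> linarith [Real.pi_pos]⟩

/-- The shape of the regular triangle lattice `ℤ + ℤ ω`. -/
def triangleShape : ModularSurface := ModularSurface.mk omega

/-! ### The space of unimodular lattices and the diagonal group -/

/-- `SL₃(ℝ)`. -/
abbrev SL3R : Type := Matrix.SpecialLinearGroup (Fin 3) ℝ

/-- `SL₃(ℤ)` as a subgroup of `SL₃(ℝ)`. -/
def SL3Z : Subgroup SL3R :=
  (Matrix.SpecialLinearGroup.map (n := Fin 3) (Int.castRingHom ℝ)).range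

/-- The space `SL₃(ℝ) / SL₃(ℤ)`. The coset of `g` stands for the unimodular lattice `g ℤ³`. -/
def LatticeSpace : Type := SL3R ⧸ SL3Z

/-- The coset `g SL₃(ℤ)`. -/
def LatticeSpace.mk (g : SL3R) : LatticeSpace := (QuotientGroup.mk g : SL3R ⧸ SL3Z)

instance : TopologicalSpace LatticeSpace := inferInstanceAs (TopologicalSpace (SL3R ⧸ SL3Z))

instance : MulAction SL3R LatticeSpace := inferInstanceAs (MulAction SL3R (SL3R ⧸ SL3Z))

instance : MeasurableSpace LatticeSpace := borel LatticeSpace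

instance : BorelSpace LatticeSpace := ⟨rfl⟩

/-- The group `A` of diagonal matrices in `SL₃(ℝ)` with positive diagonal entries. -/
def diagGroup : Subgroup SL3R where
  carrier := {g | ∃ e : Fin 3 → ℝ, (∀ i, 0 < e i) ∧
    (g : Matrix (Fin 3) (Fin 3) ℝ) = Matrix.diagonal e}
  one_mem' := ⟨fun _ => 1, fun _ => one_pos, by simp⟩
  mul_mem' := by
    rintro g g' ⟨e, he, hg⟩ ⟨e', he', hg'⟩
    refine ⟨fun i => e i * e' i, fun i => mul_pos (he i) (he' i), ?_⟩
    rw [Matrix.SpecialLinearGroup.coe_mul, hg, hg', Matrix.diagonal_mul_diagonal]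
  inv_mem' := by
    rintro g ⟨e, he, hg⟩
    refine ⟨fun i => (e i)⁻¹, fun i => inv_pos.mpr (he i), ?_⟩
    have h1 : (g : Matrix (Fin 3) (Fin 3) ℝ) * Matrix.diagonal (fun i => (e i)⁻¹) = 1 := by
      rw [hg, Matrix.diagonal_mul_diagonal, ← Matrix.diagonal_one]
      congr 1
      funext i
      exact mul_inv_cancel₀ (he i).ne'
    have h2 : ((g⁻¹ : SL3R) : Matrix (Fin 3) (Fin 3) ℝ) * (g : Matrix (Fin 3) (Fin 3) ℝ) = 1 := by
      rw [← Matrix.SpecialLinearGroup.coe_mul, inv_mul_cancel, Matrix.SpecialLinearGroup.coe_one]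
    exact left_inv_eq_right_inv h2 h1

/-- `x` is the point of `SL₃(ℝ) / SL₃(ℤ)` that corresponds to the order `O`, for some enumeration
`σ₁, σ₂, σ₃` of the real embeddings of the field: `x` is the class of a matrix `g` of determinant
`1` for which `g ℤ³` is a positive multiple of the lattice
`φ(O) = {(σ₁ α, σ₂ α, σ₃ α) | α ∈ O}`; the condition on the determinant forces the factor `r` to be
the one that gives `r φ(O)` covolume `1`. -/
def IsOrderPoint {K : Type*} [Field K] (O : Subalgebra ℤ K) (x : LatticeSpace) : Prop :=
  ∃ (σ : Fin 3 → (K →+* ℝ)) (r : ℝ) (g : SL3R), Function.Bijective σ ∧ 0 < r ∧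
    {v : Fin 3 → ℝ | ∃ n : Fin 3 → ℤ,
      v = (g : Matrix (Fin 3) (Fin 3) ℝ).mulVec fun i => (n i : ℝ)} =
      {v : Fin 3 → ℝ | ∃ α ∈ O, v = r • fun i => σ i α} ∧
    x = LatticeSpace.mk g

/-- `μ` is an `A`-invariant (Borel) probability measure supported on the orbit `A x`. -/
def IsPeriodicMeasure (x : LatticeSpace) (μ : Measure LatticeSpace) : Prop :=
  IsProbabilityMeasure μ ∧ SMulInvariantMeasure diagGroup LatticeSpace μ ∧
    μ (MulAction.orbit diagGroup x)ᶜ = 0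

/-- Full escape of mass along a filter: weak-* convergence to the zero measure, that is, against
all continuous functions of compact support. -/
def FullEscapeOfMass {ι : Type*} (l : Filter ι) (μ : ι → Measure LatticeSpace) : Prop :=
  ∀ f : LatticeSpace → ℝ, Continuous f → HasCompactSupport f →
    Tendsto (fun i => ∫ x, f x ∂(μ i)) l (𝓝 0)

end

end CubicOrders

namespace CubicOrders

/-- `U` and `V` are vectors of sum zero within `C` of `(-L, 0, L)` and `(0, -L, L)`. -/
structure HexApprox (C L : ℝ) (U V : Fin 3 → ℝ) : Prop where
  sum_u : ∑ i, U i = 0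
  sum_v : ∑ i, V i = 0
  u0 : |U 0 + L| ≤ C
  u1 : |U 1| ≤ C
  u2 : |U 2 - L| ≤ C
  v0 : |V 0| ≤ C
  v1 : |V 1 + L| ≤ C
  v2 : |V 2 - L| ≤ C

namespace HexApprox

variable {C L : ℝ} {U V : Fin 3 → ℝ}

lemma nonneg (H : HexApprox C L U V) : 0 ≤ C := (abs_nonneg _).trans H.u1

lemma det_pos (H : HexApprox C L U V) (hL : 2 * C < L) : 0 < U 0 * V 1 - U 1 * V 0 := by
  have hC := H.nonneg
  have h0 := abs_le.1 H.u0
  have h1 := abs_le.1 H.v1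
  have h2 : |U 1 * V 0| ≤ C * C := by
    rw [abs_mul]; exact mul_le_mul H.u1 H.v0 (abs_nonneg _) hC
  have h3 := (abs_le.1 h2).2
  have h4 : (L - C) * (L - C) ≤ (-U 0) * (-V 1) :=
    mul_le_mul (by linarith) (by linarith) (by linarith) (by linarith)
  nlinarith

lemma exists_coord (H : HexApprox C L U V) (hL : 2 * C < L) (w : Fin 3 → ℝ)
    (hw : ∑ i, w i = 0) : ∃ x y : ℝ, ∀ i, w i = x * U i + y * V i := by
  have hd := H.det_pos hL
  have hu := H.sum_u
  have hv := H.sum_v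
  rw [Fin.sum_univ_three] at hw hu hv
  set D := U 0 * V 1 - U 1 * V 0 with hD
  refine ⟨(w 0 * V 1 - w 1 * V 0) / D, (U 0 * w 1 - U 1 * w 0) / D, ?_⟩
  have e0 : w 0 = (w 0 * V 1 - w 1 * V 0) / D * U 0 + (U 0 * w 1 - U 1 * w 0) / D * V 0 := by
    field_simp; rw [hD]; ring
  have e1 : w 1 = (w 0 * V 1 - w 1 * V 0) / D * U 1 + (U 0 * w 1 - U 1 * w 0) / D * V 1 := by
    field_simp; rw [hD]; ring
  rw [Fin.forall_fin_succ, Fin.forall_fin_two]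
  refine ⟨e0, e1, ?_⟩
  change w 2 = _ * U 2 + _ * V 2
  rw [show w 2 = -w 0 - w 1 by linarith, show U 2 = -U 0 - U 1 by linarith,
    show V 2 = -V 0 - V 1 by linarith]
  linear_combination -e0 - e1

lemma coord_unique (H : HexApprox C L U V) (hL : 2 * C < L) {x y : ℝ}
    (h : ∀ i, x * U i + y * V i = 0) : x = 0 ∧ y = 0 := by
  have hd := (H.det_pos hL).ne'
  have h0 := h 0
  have h1 := h 1
  constructor
  · apply (mul_eq_zero.1 (?_ : x * (U 0 * V 1 - U 1 * V 0) = 0)).resolve_right hd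
    linear_combination V 1 * h0 - V 0 * h1
  · apply (mul_eq_zero.1 (?_ : y * (U 0 * V 1 - U 1 * V 0) = 0)).resolve_right hd
    linear_combination U 0 * h1 - U 1 * h0

lemma abs_lin_comb (H : HexApprox C L U V) {x y : ℝ} {R : ℝ} (hx : |x| + |y| ≤ R) :
    |x * U 0 + y * V 0 + x * L| ≤ R * C ∧ |x * U 1 + y * V 1 + y * L| ≤ R * C ∧
      |x * U 2 + y * V 2 - (x + y) * L| ≤ R * C := by
  have key : ∀ m n : ℝ, |m| ≤ C → |n| ≤ C → |x * m + y * n| ≤ R * C := fun m n hm hn =>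
    calc |x * m + y * n| ≤ |x| * |m| + |y| * |n| := by
          rw [← abs_mul, ← abs_mul]; exact abs_add_le _ _
      _ ≤ |x| * C + |y| * C := by gcongr
      _ = (|x| + |y|) * C := by ring
      _ ≤ R * C := by gcongr; exact H.nonneg
  refine ⟨?_, ?_, ?_⟩
  · convert key _ _ H.u0 H.v0 using 2; ring
  · convert key _ _ H.u1 H.v1 using 2; ring
  · convert key _ _ H.u2 H.v2 using 2; ring

/-- The sum of the pairwise maxima of a short combination. -/
lemma sum_max_le (H : HexApprox C L U V) (hL : 0 ≤ L) {x y : ℝ} (hx : |x| ≤ 1 / 2)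
    (hy : |y| ≤ 1 / 2) {w : Fin 3 → ℝ} (hw : ∀ i, w i = x * U i + y * V i) :
    max (w 0) (w 1) + max (w 0) (w 2) + max (w 1) (w 2) ≤ 3 / 2 * L + 3 * C := by
  obtain ⟨h0, h1, h2⟩ := H.abs_lin_comb (x := x) (y := y) (R := 1) (by linarith)
  rw [← hw] at h0 h1 h2
  rw [abs_le] at h0 h1 h2 hx hy
  have p1 : x * L ≤ 1 / 2 * L := by gcongr; exact hx.2
  have p2 : -(1 / 2) * L ≤ x * L := by gcongr; linarith [hx.1]
  have p3 : y * L ≤ 1 / 2 * L := by gcongr; exact hy.2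
  have p4 : -(1 / 2) * L ≤ y * L := by gcongr; linarith [hy.1]
  have e : (x + y) * L = x * L + y * L := by ring
  rw [e] at h2
  have hC := H.nonneg
  rcases le_total (w 0) (w 1) with a | a <;> rcases le_total (w 0) (w 2) with b | b <;>
    rcases le_total (w 1) (w 2) with c | c <;> simp only [max_eq_left, max_eq_right, a, b, c] <;>
    linarith

/-- A point all of whose translates stay large in some coordinate is close to the deep hole. -/
lemma near_hole (H : HexApprox C L U V) (hL : 0 < L) {P Q D δ : ℝ} (hδ : δ ≤ 1 / 10)
    (hD : D + 4 * C ≤ δ * L)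
    (h : ∀ m n : ℤ, ∃ i, 2 / 3 * L - D ≤ (m - P) * U i + (n - Q) * V i) :
    ∃ n : ℤ, |P + 1 / 3 - n| ≤ 2 * δ := by
  have hC := H.nonneg
  have bnd : ∀ P : ℝ, ∃ m : ℤ, ∃ p : ℝ, P = p + m ∧ -(1 / 3) ≤ p ∧ p ≤ 2 / 3 := fun P =>
    ⟨⌈P - 2 / 3⌉, P - ⌈P - 2 / 3⌉, by ring, by linarith [Int.ceil_lt_add_one (P - 2 / 3)],
      by linarith [Int.le_ceil (P - 2 / 3)]⟩
  obtain ⟨m, p, rfl, p1, p2⟩ := bnd P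
  obtain ⟨n, q, rfl, q1, q2⟩ := bnd Q
  have fin3 : ∀ p : Fin 3 → Prop, (∃ i, p i) → p 0 ∨ p 1 ∨ p 2 := by
    rintro p ⟨i, hi⟩; fin_cases i <;> tauto
  have cond : ∀ x y : ℝ, |x| + |y| ≤ 4 →
      (∃ i, 2 / 3 * L - D ≤ x * U i + y * V i) →
      2 / 3 - δ ≤ -x ∨ 2 / 3 - δ ≤ -y ∨ 2 / 3 - δ ≤ x + y := by
    intro x y hxy hi
    obtain ⟨h0, h1, h2⟩ := H.abs_lin_comb hxy
    rw [abs_le] at h0 h1 h2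
    rcases fin3 _ hi with hi | hi | hi
    · left; refine le_of_mul_le_mul_right (?_ : _ * L ≤ _ * L) hL; linarith
    · right; left; refine le_of_mul_le_mul_right (?_ : _ * L ≤ _ * L) hL; linarith
    · right; right; refine le_of_mul_le_mul_right (?_ : _ * L ≤ _ * L) hL; linarith
  have hδ0 : 0 ≤ δ ∨ δ < 0 := le_or_gt 0 δ
  have A := cond (-p) (-q) (by
    rw [abs_neg, abs_neg]
    have := abs_le.2 (⟨by linarith, p2⟩ : -(2 / 3) ≤ p ∧ p ≤ 2 / 3)
    have := abs_le.2 (⟨by linarith, q2⟩ : -(2 / 3) ≤ q ∧ q ≤ 2 / 3)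
    linarith) (by
    obtain ⟨i, hi⟩ := h m n
    exact ⟨i, by convert hi using 3 <;> ring⟩)
  have B := cond (-p) (1 - q) (by
    have := abs_le.2 (⟨by linarith, by linarith⟩ : -2 ≤ -p ∧ -p ≤ 2)
    have := abs_le.2 (⟨by linarith, by linarith⟩ : -2 ≤ 1 - q ∧ 1 - q ≤ 2)
    linarith) (by
    obtain ⟨i, hi⟩ := h m (n + 1)
    exact ⟨i, by push_cast at hi; convert hi using 3 <;> ring⟩)
  have c1 : 2 / 3 - δ ≤ p → ∃ k : ℤ, |p + m + 1 / 3 - k| ≤ 2 * δ := fun hp => by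
    refine ⟨m + 1, ?_⟩
    push_cast
    rw [abs_le]; constructor <;> linarith
  have c2 : p ≤ -(1 / 3) + 2 * δ → ∃ k : ℤ, |p + m + 1 / 3 - k| ≤ 2 * δ := fun hp => by
    refine ⟨m, ?_⟩
    rw [abs_le]; constructor <;> linarith
  rcases A with A | A | A
  · exact c1 (by linarith)
  · rcases B with B | B | B
    · exact c1 (by linarith)
    · linarith
    · exact c2 (by linarith)
  · rcases hδ0 with hδ0 | hδ0
    · exact c2 (by linarith)
    · linarith

end HexApprox

/-- A root of `x³ + p x² + q x + r + t (a x - b) (c x - d)` close to `b / a`. -/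
lemma exists_root_near (a b c d p q r : ℝ) (ha : a ≠ 0) (hne : c * b - a * d ≠ 0) :
    ∃ S N : ℝ, 0 < S ∧ 0 < N ∧ ∀ t : ℝ, N ≤ |t| → ∃ x,
      x ^ 3 + p * x ^ 2 + q * x + r + t * ((a * x - b) * (c * x - d)) = 0 ∧
      |a * x - b| ≤ S / |t| := by
  set H : ℝ → ℝ := fun x => x ^ 3 + p * x ^ 2 + q * x + r with hH
  set g : ℝ → ℝ → ℝ := fun s τ => H (b / a + s * τ) + s * (a * c * s * τ + (c * b - a * d)) with hg
  set S := (|H (b / a)| + 1) / |c * b - a * d| with hS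
  have hS0 : 0 < S := by positivity
  have hneg : g S 0 * g (-S) 0 < 0 := by
    have e : g S 0 * g (-S) 0 = H (b / a) ^ 2 - (S * (c * b - a * d)) ^ 2 := by
      simp only [hg, mul_zero, add_zero]; ring
    have e2 : (S * (c * b - a * d)) ^ 2 = (|H (b / a)| + 1) ^ 2 := by
      rw [← sq_abs, abs_mul, abs_of_pos hS0, hS, div_mul_cancel₀ _ (abs_ne_zero.2 hne)]
    rw [e, e2, ← sq_abs (H _)]
    nlinarith [abs_nonneg (H (b / a))]
  have hcont : Continuous fun τ => g S τ * g (-S) τ := by fun_prop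
  have hev : ∀ᶠ τ in 𝓝 (0 : ℝ), g S τ * g (-S) τ < 0 :=
    hcont.continuousAt.eventually_lt continuousAt_const hneg
  obtain ⟨η, hη, hball⟩ := Metric.eventually_nhds_iff.1 hev
  refine ⟨|a| * S, 2 / η, by positivity, by positivity, fun t ht => ?_⟩
  have ht0 : 0 < |t| := lt_of_lt_of_le (by positivity) ht
  have htne : t ≠ 0 := abs_pos.1 ht0
  have h1 : g S t⁻¹ * g (-S) t⁻¹ < 0 := by
    apply hball
    rw [dist_zero_right, Real.norm_eq_abs, abs_inv]
    rw [inv_lt_comm₀ ht0 hη]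
    refine lt_of_lt_of_le ?_ ht
    rw [inv_eq_one_div]; gcongr; norm_num
  have hgc : ContinuousOn (fun s => g s t⁻¹) (Set.uIcc (-S) S) := by
    apply Continuous.continuousOn; fun_prop
  have h0 : (0 : ℝ) ∈ Set.uIcc (g (-S) t⁻¹) (g S t⁻¹) := by
    rw [Set.mem_uIcc]
    rcases mul_neg_iff.1 h1 with h | h
    · left; exact ⟨h.2.le, h.1.le⟩
    · right; exact ⟨h.1.le, h.2.le⟩
  obtain ⟨s, hs, hs0⟩ := intermediate_value_uIcc hgc h0
  rw [Set.uIcc_of_le (by linarith), Set.mem_Icc, ← abs_le] at hs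
  have e : a * (b / a + s * t⁻¹) - b = a * s * t⁻¹ := by field_simp; ring
  refine ⟨b / a + s * t⁻¹, ?_, ?_⟩
  · rw [← hs0]
    simp only [hg, hH]
    rw [e]
    field_simp
    ring
  · rw [e, abs_mul, abs_mul, abs_inv, div_eq_mul_inv]
    gcongr

set_option maxHeartbeats 800000 in
/-- The three roots of `x³ + p x² + q x + r + t (a x - b) (c x - d)` for large `t`. -/
lemma exists_roots (a b c d p q r : ℝ) (ha : 1 ≤ |a|) (hc : 1 ≤ |c|)
    (hne : 1 ≤ |c * b - a * d|) : ∃ B N : ℝ, 1 ≤ B ∧ 1 ≤ N ∧ ∀ t : ℝ, N ≤ |t| → ∃ x y z : ℝ,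
      (x + y + z = -(p + t * (a * c)) ∧ x * y + x * z + y * z = q - t * (a * d + b * c) ∧
        x * y * z = -(r + t * (b * d))) ∧
      (B⁻¹ ≤ |c * x - d| ∧ |c * x - d| ≤ B) ∧
      (B⁻¹ ≤ |a * y - b| ∧ |a * y - b| ≤ B) ∧
      (B⁻¹ * |t| ≤ |a * z - b| ∧ |a * z - b| ≤ B * |t|) ∧
      (B⁻¹ * |t| ≤ |c * z - d| ∧ |c * z - d| ≤ B * |t|) ∧
      B⁻¹ ≤ |x - y| ∧ B⁻¹ * |t| ≤ |x - z| ∧ B⁻¹ * |t| ≤ |y - z| := by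
  have hdrop : ∀ {m n k : ℝ}, 1 ≤ m → 0 ≤ n → m * n ≤ k → n ≤ k := fun hm hn h =>
    (le_mul_of_one_le_left hn hm).trans h
  have ha0 : a ≠ 0 := by rintro rfl; norm_num at ha
  have hc0 : c ≠ 0 := by rintro rfl; norm_num at hc
  have hne0 : c * b - a * d ≠ 0 := by intro h; rw [h] at hne; norm_num at hne
  obtain ⟨S, N, hS, hN, hroot⟩ := exists_root_near a b c d p q r ha0 hne0
  obtain ⟨S', N', hS', hN', hroot'⟩ := exists_root_near c d a b p q r hc0
    (by rw [← neg_ne_zero]; convert hne0 using 1; ring)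
  obtain ⟨E, hE⟩ : ∃ E, E = |p| + |b| + |d| + 2 := ⟨_, rfl⟩
  have hE0 : 2 ≤ E := by rw [hE]; have := abs_nonneg p; have := abs_nonneg b
                         have := abs_nonneg d; linarith
  set Δ := |c * b - a * d|
  obtain ⟨B, hB⟩ : ∃ B, B = 4 * (|a| * |c|) + Δ + |a| * (|a| * |c| + E) + |b| + (|c| * (|a| * |c| + E) + |d|) + 4 := ⟨_, rfl⟩
  have hac : 1 ≤ |a| * |c| := one_le_mul_of_one_le_of_one_le ha hc
  have pa : 0 ≤ |a| * (|a| * |c| + E) := by positivity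
  have pc : 0 ≤ |c| * (|a| * |c| + E) := by positivity
  have nb := abs_nonneg b
  have nd := abs_nonneg d
  have hB1 : 4 ≤ B := by rw [hB]; linarith
  have hBpos : 0 < B := by linarith
  have hBa : B⁻¹ ≤ 1 / 4 * (|a| * |c|)⁻¹ := by
    rw [one_div, ← mul_inv]; apply inv_anti₀ (by positivity); rw [hB]; linarith
  have hBh : B⁻¹ ≤ 1 / 2 := by rw [one_div]; apply inv_anti₀ (by norm_num); linarith
  obtain ⟨M, hM⟩ : ∃ M, M = 4 * (|a| * |c|) * (S + S') + N + N' + 2 * (E + |b| + |d| + 1) := ⟨_, rfl⟩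
  have hM0 : 0 ≤ 4 * (|a| * |c|) * (S + S') := by positivity
  refine ⟨B, M, by linarith, by linarith, fun t ht => ?_⟩
  obtain ⟨x, hx, hxs⟩ := hroot t (by linarith)
  obtain ⟨y, hy, hys⟩ := hroot' t (by linarith)
  have ht0 : 0 < |t| := by linarith
  have small : ∀ s : ℝ, s ≤ S + S' → s / |t| ≤ 1 / 4 * (|a| * |c|)⁻¹ := by
    intro s hs
    rw [div_le_iff₀ ht0]
    calc s ≤ S + S' := hs
      _ = 1 / 4 * (|a| * |c|)⁻¹ * (4 * (|a| * |c|) * (S + S')) := by field_simp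
      _ ≤ 1 / 4 * (|a| * |c|)⁻¹ * |t| := by gcongr; linarith
  replace hxs := hxs.trans (small S (by linarith))
  replace hys := hys.trans (small S' (by linarith))
  have hxc : |c| * |a * x - b| ≤ 1 / 4 := by
    calc |c| * |a * x - b| ≤ |c| * (1 / 4 * (|a| * |c|)⁻¹) := by gcongr
      _ = 1 / 4 * |a|⁻¹ := by field_simp
      _ ≤ 1 / 4 := by have := inv_le_one_of_one_le₀ ha; linarith
  have hya : |a| * |c * y - d| ≤ 1 / 4 := by
    calc |a| * |c * y - d| ≤ |a| * (1 / 4 * (|a| * |c|)⁻¹) := by gcongr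
      _ = 1 / 4 * |c|⁻¹ := by field_simp
      _ ≤ 1 / 4 := by have := inv_le_one_of_one_le₀ hc; linarith
  have hx4 : |a * x - b| ≤ 1 / 4 := hdrop hc (abs_nonneg _) hxc
  have hy4 : |c * y - d| ≤ 1 / 4 := hdrop ha (abs_nonneg _) hya
  have hxabs : |x| ≤ |b| + 1 := by
    have : |a| * |x| ≤ |b| + 1 := by
      rw [← abs_mul]
      have := abs_add_le (a * x - b) b
      rw [sub_add_cancel] at this; linarith
    exact hdrop ha (abs_nonneg _) this
  have hyabs : |y| ≤ |d| + 1 := by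
    have : |c| * |y| ≤ |d| + 1 := by
      rw [← abs_mul]
      have := abs_add_le (c * y - d) d
      rw [sub_add_cancel] at this; linarith
    exact hdrop hc (abs_nonneg _) this
  have hcx : |(|a| * |c * x - d|) - Δ| ≤ 1 / 4 := by
    rw [← abs_mul]
    refine (abs_abs_sub_abs_le _ _).trans ?_
    refine le_trans (le_of_eq ?_) hxc
    rw [← abs_mul]; congr 1; ring
  have hay : |(|c| * |a * y - b|) - Δ| ≤ 1 / 4 := by
    rw [← abs_mul, show Δ = |a * d - c * b| from abs_sub_comm _ _]
    refine (abs_abs_sub_abs_le _ _).trans ?_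
    refine le_trans (le_of_eq ?_) hya
    rw [← abs_mul]; congr 1; ring
  have hxy : 1 / 2 ≤ |a| * |c| * |x - y| := by
    have e : c * b - a * d = a * c * (x - y) - c * (a * x - b) + a * (c * y - d) := by ring
    have h1 : Δ ≤ |a * c * (x - y)| + |c * (a * x - b)| + |a * (c * y - d)| := by
      rw [show Δ = |c * b - a * d| from rfl, e]
      exact (abs_add_le _ _).trans (add_le_add_left (abs_sub _ _) _)
    rw [abs_mul c, abs_mul a (c * y - d), abs_mul, abs_mul] at h1
    linarith
  have hxyne : x - y ≠ 0 := by
    intro h; rw [h] at hxy; norm_num at hxy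
  rw [abs_le] at hcx hay
  have hlow : ∀ m n : ℝ, 1 ≤ m → m ≤ |a| * |c| → 0 ≤ n → 1 / 2 ≤ m * n → B⁻¹ ≤ n := by
    intro m n hm hm' hn h
    refine hBa.trans ?_
    rw [← div_eq_mul_inv, div_le_iff₀ (by positivity)]
    have := mul_le_mul_of_nonneg_left hm' hn
    linarith
  have ha_le : |a| ≤ |a| * |c| := le_mul_of_one_le_right (abs_nonneg _) hc
  have hc_le : |c| ≤ |a| * |c| := le_mul_of_one_le_left (abs_nonneg _) ha
  obtain ⟨z, hz⟩ : ∃ z, z = -(p + t * (a * c)) - x - y := ⟨_, rfl⟩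
  have hzE : |z + t * (a * c)| ≤ E := by
    have e : z + t * (a * c) = -(p + x + y) := by rw [hz]; ring
    rw [e, abs_neg]
    refine (abs_add_three _ _ _).trans ?_
    linarith
  have htac : |t * (a * c)| = |t| * (|a| * |c|) := by rw [abs_mul, abs_mul]
  have hz1 : |t| * (|a| * |c|) ≤ |z| + E := by
    rw [← htac]
    have := abs_sub (z + t * (a * c)) z
    rw [add_sub_cancel_left] at this; linarith
  have hz2 : |z| ≤ |t| * (|a| * |c|) + E := by
    rw [← htac]
    have := abs_sub (z + t * (a * c)) (t * (a * c))
    rw [add_sub_cancel_right] at this; linarith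
  have hz3 : |t| - E ≤ |z| := by
    have := le_mul_of_one_le_right ht0.le hac
    linarith
  have zlow : ∀ w : ℝ, |w| ≤ |b| + |d| + 1 → B⁻¹ * |t| ≤ |z| - |w| := by
    intro w hw
    have : B⁻¹ * |t| ≤ 1 / 2 * |t| := by gcongr
    linarith
  have zup : ∀ m n : ℝ, 1 ≤ |t| → |m * z - n| ≤ (|m| * (|a| * |c| + E) + |n|) * |t| := by
    intro m n h1
    calc |m * z - n| ≤ |m| * |z| + |n| := by rw [← abs_mul]; exact abs_sub _ _
      _ ≤ |m| * (|t| * (|a| * |c|) + E * |t|) + |n| * |t| := by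
          gcongr
          · exact hz2.trans (by gcongr; exact le_mul_of_one_le_right (by linarith) h1)
          · exact le_mul_of_one_le_right (abs_nonneg _) h1
      _ = _ := by ring
  have zlow' : ∀ m n : ℝ, 1 ≤ |m| → |n| ≤ |b| + |d| + 1 → B⁻¹ * |t| ≤ |m * z - n| := by
    intro m n h1 h2
    refine (zlow n h2).trans ?_
    have := abs_sub_abs_le_abs_sub (m * z) n
    rw [abs_mul] at this
    have := le_mul_of_one_le_left (abs_nonneg z) h1
    linarith
  have ht1 : 1 ≤ |t| := by linarith
  refine ⟨x, y, z, ⟨by rw [hz]; ring, ?_, ?_⟩, ⟨?_, ?_⟩, ⟨?_, ?_⟩, ⟨?_, ?_⟩, ⟨?_, ?_⟩, ?_, ?_, ?_⟩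
  · apply mul_left_cancel₀ hxyne
    rw [hz]
    linear_combination hy - hx
  · apply mul_left_cancel₀ hxyne
    rw [hz]
    linear_combination x * hy - y * hx
  · exact hlow |a| _ ha ha_le (abs_nonneg _) (by linarith)
  · refine hdrop ha (abs_nonneg _) (?_ : _ ≤ B)
    linarith
  · exact hlow |c| _ hc hc_le (abs_nonneg _) (by linarith)
  · refine hdrop hc (abs_nonneg _) (?_ : _ ≤ B)
    linarith
  · exact zlow' a b ha (by linarith)
  · refine (zup a b ht1).trans ?_
    gcongr; linarith
  · exact zlow' c d hc (by linarith)
  · refine (zup c d ht1).trans ?_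
    gcongr; linarith
  · exact hlow (|a| * |c|) _ hac le_rfl (abs_nonneg _) hxy
  · refine (zlow x (by linarith)).trans ?_
    rw [abs_sub_comm]; exact abs_sub_abs_le_abs_sub z _
  · refine (zlow y (by linarith)).trans ?_
    rw [abs_sub_comm]; exact abs_sub_abs_le_abs_sub z _

lemma abs_log_sub_le {B x s : ℝ} (hB : 1 ≤ B) (hs : 0 < s) (h1 : B⁻¹ * s ≤ |x|)
    (h2 : |x| ≤ B * s) : |Real.log |x| - Real.log s| ≤ Real.log B := by
  have hB0 : 0 < B := by linarith
  have hx : 0 < |x| := lt_of_lt_of_le (by positivity) h1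
  have l1 := Real.log_le_log (by positivity) h1
  have l2 := Real.log_le_log hx h2
  rw [Real.log_mul (by positivity) hs.ne'] at l1 l2
  rw [Real.log_inv] at l1
  rw [abs_le]; constructor <;> linarith

/-- What is used about the roots of `x³ + p x² + q x + r + t (a x - b) (c x - d)`; the constant
`C` and `L = log |t|` control their sizes. -/
structure RootData (a b c d p q r : ℤ) (C L t : ℝ) (x : Fin 3 → ℝ) : Prop where
  e1 : x 0 + x 1 + x 2 = -(p + t * (a * c))
  e2 : x 0 * x 1 + x 0 * x 2 + x 1 * x 2 = q - t * (a * d + b * c)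
  e3 : x 0 * x 1 * x 2 = -(r + t * (b * d))
  hex : HexApprox C L (fun i => Real.log |a * x i - b|) (fun i => Real.log |c * x i - d|)
  disc : Real.exp (2 * L - C) ≤ |(x 0 - x 1) * (x 0 - x 2) * (x 1 - x 2)|

lemma exists_rootData (a b c d p q r : ℤ) (ha : a ≠ 0) (hc : c ≠ 0) (hne : c * b - a * d ≠ 0)
    (h₁ : |b ^ 3 + p * a * b ^ 2 + q * a ^ 2 * b + r * a ^ 3| = 1)
    (h₂ : |d ^ 3 + p * c * d ^ 2 + q * c ^ 2 * d + r * c ^ 3| = 1) :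
    ∃ C N : ℝ, ∀ t : ℝ, N ≤ |t| → ∃ x, RootData a b c d p q r C (Real.log |t|) t x := by
  have one_le : ∀ n : ℤ, n ≠ 0 → (1 : ℝ) ≤ |(n : ℝ)| := fun n hn => by
    exact_mod_cast Int.one_le_abs hn
  obtain ⟨B, N, hB, hN, H⟩ := exists_roots a b c d p q r (one_le a ha) (one_le c hc)
    (by exact_mod_cast one_le _ hne)
  refine ⟨3 * Real.log B, N, fun t ht => ?_⟩
  have ht0 : 0 < |t| := by linarith
  have hB0 : 0 < B := by linarith
  have hBi : 0 < B⁻¹ := by positivity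
  have hlB := Real.log_nonneg hB
  obtain ⟨x, y, z, ⟨e1, e2, e3⟩, hcx, hay, haz, hcz, hxy, hxz, hyz⟩ := H t ht
  have n₁ : |a * x - b| * |a * y - b| * |a * z - b| = 1 := by
    have : ((|b ^ 3 + p * a * b ^ 2 + q * a ^ 2 * b + r * a ^ 3| : ℤ) : ℝ) = 1 := by
      rw [h₁]; norm_num
    rw [← this]
    push_cast
    rw [← abs_mul, ← abs_mul, ← abs_neg]
    congr 1
    linear_combination (-(a : ℝ)) ^ 3 * e3 + (a : ℝ) ^ 2 * b * e2 - a * (b : ℝ) ^ 2 * e1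
  have n₂ : |c * x - d| * |c * y - d| * |c * z - d| = 1 := by
    have : ((|d ^ 3 + p * c * d ^ 2 + q * c ^ 2 * d + r * c ^ 3| : ℤ) : ℝ) = 1 := by
      rw [h₂]; norm_num
    rw [← this]
    push_cast
    rw [← abs_mul, ← abs_mul, ← abs_neg]
    congr 1
    linear_combination (-(c : ℝ)) ^ 3 * e3 + (c : ℝ) ^ 2 * d * e2 - c * (d : ℝ) ^ 2 * e1
  have hay0 : 0 < |a * y - b| := hBi.trans_le hay.1
  have hcx0 : 0 < |c * x - d| := hBi.trans_le hcx.1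
  have haz0 : 0 < |a * z - b| := lt_of_lt_of_le (by positivity) haz.1
  have hcz0 : 0 < |c * z - d| := lt_of_lt_of_le (by positivity) hcz.1
  have hax0 : |a * x - b| ≠ 0 := by intro h; rw [h] at n₁; norm_num at n₁
  have hcy0 : |c * y - d| ≠ 0 := by intro h; rw [h] at n₂; norm_num at n₂
  have s₁ : Real.log |a * x - b| + Real.log |a * y - b| + Real.log |a * z - b| = 0 := by
    rw [← Real.log_mul hax0 hay0.ne', ← Real.log_mul (by positivity) haz0.ne', n₁, Real.log_one]
  have s₂ : Real.log |c * x - d| + Real.log |c * y - d| + Real.log |c * z - d| = 0 := by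
    rw [← Real.log_mul hcx0.ne' hcy0, ← Real.log_mul (by positivity) hcz0.ne', n₂, Real.log_one]
  have l1 := abs_log_sub_le hB one_pos (by simpa using hay.1) (by simpa using hay.2)
  have l2 := abs_log_sub_le hB one_pos (by simpa using hcx.1) (by simpa using hcx.2)
  have l3 := abs_log_sub_le hB ht0 haz.1 haz.2
  have l4 := abs_log_sub_le hB ht0 hcz.1 hcz.2
  rw [Real.log_one, sub_zero] at l1 l2
  have l1' := abs_le.1 l1
  have l2' := abs_le.1 l2
  have l3' := abs_le.1 l3
  have l4' := abs_le.1 l4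
  refine ⟨![x, y, z], e1, e2, e3, ⟨?_, ?_, ?_, ?_, ?_, ?_, ?_, ?_⟩, ?_⟩
  · rw [Fin.sum_univ_three]; exact s₁
  · rw [Fin.sum_univ_three]; exact s₂
  · change |Real.log |a * x - b| + _| ≤ _
    rw [abs_le]; constructor <;> linarith
  · exact l1.trans (by linarith)
  · exact l3.trans (by linarith)
  · exact l2.trans (by linarith)
  · change |Real.log |c * y - d| + _| ≤ _
    rw [abs_le]; constructor <;> linarith
  · exact l4.trans (by linarith)
  · change _ ≤ |(x - y) * (x - z) * (y - z)|
    rw [abs_mul, abs_mul]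
    calc Real.exp (2 * Real.log |t| - 3 * Real.log B)
        = B⁻¹ * (B⁻¹ * |t|) * (B⁻¹ * |t|) := by
          rw [sub_eq_add_neg, Real.exp_add, two_mul, Real.exp_add,
            Real.exp_log ht0, show -(3 * Real.log B) = Real.log (B⁻¹) + Real.log (B⁻¹) + Real.log (B⁻¹) by
              rw [Real.log_inv]; ring, Real.exp_add, Real.exp_add, Real.exp_log hBi]
          ring
      _ ≤ _ := by gcongr

lemma eventually_absAtTop {P : ℤ → Prop} :
    (∀ᶠ t in absAtTop, P t) ↔ ∃ N : ℝ, ∀ t : ℤ, N ≤ |(t : ℝ)| → P t := by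
  rw [absAtTop, Filter.eventually_comap, Filter.eventually_atTop]
  constructor
  · rintro ⟨N, hN⟩
    exact ⟨N, fun t ht => hN |t| (by exact_mod_cast ht) t rfl⟩
  · rintro ⟨N, hN⟩
    refine ⟨⌈N⌉, fun s hs t ht => hN t ?_⟩
    subst ht
    refine (Int.le_ceil N).trans ?_
    exact_mod_cast hs

lemma eventually_le_log (M : ℝ) : ∀ᶠ t : ℤ in absAtTop, M ≤ Real.log |(t : ℝ)| := by
  rw [eventually_absAtTop]
  refine ⟨Real.exp M, fun t ht => ?_⟩
  exact (Real.le_log_iff_exp_le ((Real.exp_pos _).trans_le ht)).2 ht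

lemma exists_cubic_coeffs {h : ℤ[X]} (hm : h.Monic) (hd : h.natDegree = 3) :
    ∃ p q r : ℤ, h = X ^ 3 + C p * X ^ 2 + C q * X + C r := by
  refine ⟨h.coeff 2, h.coeff 1, h.coeff 0, ?_⟩
  have h3 : h.coeff 3 = 1 := by rw [← hd]; exact hm
  conv_lhs => rw [h.as_sum_range_C_mul_X_pow, hd]
  simp only [Finset.sum_range_succ, Finset.sum_range_zero, h3, map_one]
  ring

section Family

variable {a b c d p q r : ℤ} {h : ℤ[X]}

lemma aeval_family {R : Type*} [CommRing R] (hh : h = X ^ 3 + C p * X ^ 2 + C q * X + C r)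
    (t : ℤ) (x : R) : aeval x (family a b c d h t) =
      x ^ 3 + p * x ^ 2 + q * x + r + t * ((a * x - b) * (c * x - d)) := by
  simp [family, hh]

lemma family_eq (hh : h = X ^ 3 + C p * X ^ 2 + C q * X + C r) (t : ℤ) :
    family a b c d h t = C 1 * X ^ 3 + C (p + t * (a * c)) * X ^ 2 +
      C (q - t * (a * d + b * c)) * X + C (r + t * (b * d)) := by
  simp only [family, hh, map_add, map_sub, map_mul, map_one]
  ring

lemma family_natDegree (hh : h = X ^ 3 + C p * X ^ 2 + C q * X + C r) (t : ℤ) :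
    (family a b c d h t).natDegree = 3 := by
  rw [family_eq hh, natDegree_cubic one_ne_zero]

lemma family_monic (hh : h = X ^ 3 + C p * X ^ 2 + C q * X + C r) (t : ℤ) :
    (family a b c d h t).Monic := by
  rw [family_eq hh, Monic, leadingCoeff_cubic one_ne_zero]

lemma hom_form_of_aeval (ha : a ≠ 0) (hh : h = X ^ 3 + C p * X ^ 2 + C q * X + C r)
    (h₁ : (a : ℚ) ^ 3 * aeval ((b : ℚ) / a) h = 1 ∨ (a : ℚ) ^ 3 * aeval ((b : ℚ) / a) h = -1) :
    |b ^ 3 + p * a * b ^ 2 + q * a ^ 2 * b + r * a ^ 3| = 1 := by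
  have haQ : (a : ℚ) ≠ 0 := by exact_mod_cast ha
  have e : (a : ℚ) ^ 3 * aeval ((b : ℚ) / a) h =
      ((b ^ 3 + p * a * b ^ 2 + q * a ^ 2 * b + r * a ^ 3 : ℤ) : ℚ) := by
    rw [hh]; simp; field_simp
  rw [e] at h₁
  rw [abs_eq zero_le_one]
  rcases h₁ with h₁ | h₁
  · left; exact_mod_cast h₁
  · right; exact_mod_cast h₁

/-- The value `a x - b` divides the value `a³ h(b / a)` at each root of `h + t (aX - b) (cX - d)`. -/
lemma mul_cofactor {R : Type*} [CommRing R] {t : ℤ} {x : R}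
    (hx : x ^ 3 + p * x ^ 2 + q * x + r + t * ((a * x - b) * (c * x - d)) = 0) :
    (a * x - b) * (((a ^ 2 : ℤ) : R) * x ^ 2 + ((a * b + p * a ^ 2 : ℤ) : R) * x +
      ((b ^ 2 + p * a * b + q * a ^ 2 - a ^ 3 * t * d : ℤ) : R) +
        ((a ^ 3 * t * c : ℤ) : R) * x) =
      ((-(b ^ 3 + p * a * b ^ 2 + q * a ^ 2 * b + r * a ^ 3) : ℤ) : R) := by
  push_cast
  linear_combination (a : R) ^ 3 * hx

lemma isUnit_of_root {t n : ℤ}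
    (h₁ : |b ^ 3 + p * a * b ^ 2 + q * a ^ 2 * b + r * a ^ 3| = 1)
    (hn : n ^ 3 + p * n ^ 2 + q * n + r + t * ((a * n - b) * (c * n - d)) = 0) :
    |a * n - b| = 1 := by
  rw [← Int.isUnit_iff_abs_eq] at h₁ ⊢
  have := mul_cofactor (R := ℤ) hn
  refine isUnit_of_dvd_unit (Dvd.intro _ this) ?_
  simpa only [Int.cast_id] using h₁.neg

lemma family_irreducible (ha : a ≠ 0) (hh : h = X ^ 3 + C p * X ^ 2 + C q * X + C r)
    (h₁ : |b ^ 3 + p * a * b ^ 2 + q * a ^ 2 * b + r * a ^ 3| = 1)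
    (h₂ : |d ^ 3 + p * c * d ^ 2 + q * c ^ 2 * d + r * c ^ 3| = 1) :
    ∀ᶠ t in absAtTop, Irreducible (family a b c d h t) := by
  rw [eventually_absAtTop]
  set M : ℤ := |b| + 1
  refine ⟨((M ^ 3 + |p| * M ^ 2 + |q| * M + |r| + 1 : ℤ) : ℝ), fun t ht => ?_⟩
  replace ht : M ^ 3 + |p| * M ^ 2 + |q| * M + |r| + 1 ≤ |t| := by exact_mod_cast ht
  rw [(family_monic hh t).irreducible_iff_roots_eq_zero_of_degree_le_three
    (by rw [family_natDegree hh]; norm_num) (by rw [family_natDegree hh])]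
  rw [Multiset.eq_zero_iff_forall_notMem]
  intro n hn
  have hn' := (mem_roots (family_monic hh t).ne_zero).1 hn
  have hn0 : n ^ 3 + p * n ^ 2 + q * n + r + t * ((a * n - b) * (c * n - d)) = 0 := by
    have := aeval_family (a := a) (b := b) (c := c) (d := d) (R := ℤ) hh t n
    rw [coe_aeval_eq_eval, hn'.eq_zero] at this
    simpa using this.symm
  have u1 := isUnit_of_root h₁ hn0
  have u2 := isUnit_of_root (a := c) (b := d) (c := a) (d := b) (t := t) h₂
    (by rw [mul_comm (c * n - d)]; exact hn0)
  have hnM : |n| ≤ M := by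
    have h3 : |a| * |n| ≤ |a * n - b| + |b| := by
      rw [← abs_mul]; have := abs_add_le (a * n - b) b; rwa [sub_add_cancel] at this
    have h4 : |n| ≤ |a| * |n| := le_mul_of_one_le_left (abs_nonneg _) (Int.one_le_abs ha)
    simp only [M]; linarith
  have e : |t| = |n ^ 3 + p * n ^ 2 + q * n + r| := by
    rw [eq_neg_of_add_eq_zero_left hn0, abs_neg, abs_mul, abs_mul, u1, u2]; ring
  have : |n ^ 3 + p * n ^ 2 + q * n + r| ≤ M ^ 3 + |p| * M ^ 2 + |q| * M + |r| := by
    calc |n ^ 3 + p * n ^ 2 + q * n + r| ≤ |n ^ 3| + |p * n ^ 2| + |q * n| + |r| := by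
          refine (abs_add_le _ _).trans (add_le_add_left ?_ _)
          exact abs_add_three _ _ _
      _ = |n| ^ 3 + |p| * |n| ^ 2 + |q| * |n| + |r| := by
          rw [abs_mul, abs_mul, abs_pow, abs_pow]
      _ ≤ _ := by gcongr
  linarith

lemma RootData.prod_eq {B L t : ℝ} {x : Fin 3 → ℝ} (D : RootData a b c d p q r B L t x)
    {R : Type*} [CommRing R] [Algebra ℝ R] (z : R) :
    z ^ 3 + p * z ^ 2 + q * z + r + algebraMap ℝ R t * ((a * z - b) * (c * z - d)) =
      (z - algebraMap ℝ R (x 0)) * (z - algebraMap ℝ R (x 1)) * (z - algebraMap ℝ R (x 2)) := by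
  have e1 := congrArg (algebraMap ℝ R) D.e1
  have e2 := congrArg (algebraMap ℝ R) D.e2
  have e3 := congrArg (algebraMap ℝ R) D.e3
  simp only [map_add, map_sub, map_mul, map_neg, map_intCast] at e1 e2 e3
  linear_combination z ^ 2 * e1 - z * e2 + e3

lemma RootData.injective {B L t : ℝ} {x : Fin 3 → ℝ} (D : RootData a b c d p q r B L t x) :
    Function.Injective x := by
  have h := (Real.exp_pos _).trans_le D.disc
  rw [abs_pos, mul_ne_zero_iff, mul_ne_zero_iff, sub_ne_zero, sub_ne_zero, sub_ne_zero] at h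
  obtain ⟨⟨h1, h2⟩, h3⟩ := h
  intro i j hij
  fin_cases i <;> fin_cases j <;> simp_all

lemma RootData.isTotallyReal {B L : ℝ} {t : ℤ} {x : Fin 3 → ℝ}
    (D : RootData a b c d p q r B L t x) (hh : h = X ^ 3 + C p * X ^ 2 + C q * X + C r) :
    IsTotallyReal (family a b c d h t) := by
  intro z hz
  have e := D.prod_eq z
  rw [aeval_family hh] at hz
  simp only [Complex.coe_algebraMap, Complex.ofReal_intCast] at e
  rw [hz, eq_comm, mul_eq_zero, mul_eq_zero, sub_eq_zero, sub_eq_zero, sub_eq_zero] at e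
  rcases e with (e | e) | e <;> rw [e] <;> exact Complex.ofReal_im _

/-- The real embeddings of `ℚ(θ)` and the roots of the polynomial, with what is used of them. -/
structure OrderData (a b c d p q r t : ℤ) (B L : ℝ) {K : Type*} [Field K] (θ : K)
    (σ : Fin 3 → (K →+* ℝ)) : Prop where
  root : θ ^ 3 + p * θ ^ 2 + q * θ + r + t * ((a * θ - b) * (c * θ - d)) = 0
  irr : ∀ m n : ℤ, (m : K) + n * θ = 0 → m = 0 ∧ n = 0
  bij : Function.Bijective σ
  data : RootData a b c d p q r B L t (fun i => σ i θ)

lemma exists_orderData {K : Type*} [Field K] [NumberField K] {θ : K} {t : ℤ} {B L : ℝ}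
    {x : Fin 3 → ℝ} (D : RootData a b c d p q r B L t x)
    (hh : h = X ^ 3 + C p * X ^ 2 + C q * X + C r)
    (hirr : Irreducible (family a b c d h t)) (hroot : aeval θ (family a b c d h t) = 0)
    (hθ : IntermediateField.adjoin ℚ {θ} = ⊤) :
    ∃ σ : Fin 3 → (K →+* ℝ), OrderData a b c d p q r t B L θ σ := by
  have hint : IsIntegral ℚ θ := Algebra.IsIntegral.isIntegral θ
  have hmin : (family a b c d h t).map (algebraMap ℤ ℚ) = minpoly ℚ θ := by
    apply minpoly.eq_of_irreducible_of_monic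
    · exact ((family_monic hh t).irreducible_iff_irreducible_map_fraction_map (K := ℚ)).1 hirr
    · rw [aeval_map_algebraMap, hroot]
    · exact (family_monic hh t).map _
  have htop : Algebra.adjoin ℚ {θ} = ⊤ := by
    rw [← IntermediateField.adjoin_simple_toSubalgebra_of_isAlgebraic hint.isAlgebraic, hθ,
      IntermediateField.top_toSubalgebra]
  have hx0 : ∀ i, (x i) ^ 3 + p * (x i) ^ 2 + q * (x i) + r +
      t * ((a * x i - b) * (c * x i - d)) = 0 := by
    intro i
    have e := D.prod_eq (x i)
    simp only [Algebra.algebraMap_self, RingHom.id_apply] at e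
    rw [e]
    fin_cases i <;> simp
  let pb := PowerBasis.ofAdjoinEqTop hint htop
  have hgen : pb.gen = θ := PowerBasis.ofAdjoinEqTop_gen hint htop
  have hlift : ∀ i, aeval (x i) (minpoly ℚ pb.gen) = 0 := by
    intro i
    rw [hgen, ← hmin, aeval_map_algebraMap, aeval_family hh]
    exact hx0 i
  have hσ : ∀ i, ((pb.lift (x i) (hlift i) : K →ₐ[ℚ] ℝ) : K →+* ℝ) θ = x i := by
    intro i
    have := pb.lift_gen (x i) (hlift i)
    rwa [hgen] at this
  have hrootK : θ ^ 3 + p * θ ^ 2 + q * θ + r + t * ((a * θ - b) * (c * θ - d)) = 0 := by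
    rw [← aeval_family hh, hroot]
  refine ⟨fun i => (pb.lift (x i) (hlift i) : K →ₐ[ℚ] ℝ), hrootK, ?_, ⟨?_, ?_⟩, ?_⟩
  · intro m n hmn
    by_cases hn : n = 0
    · subst hn
      simpa using hmn
    · exfalso
      have hnK : (n : K) ≠ 0 := by exact_mod_cast hn
      have e : θ = algebraMap ℚ K (-m / n) := by
        simp only [map_div₀, map_neg, map_intCast]
        field_simp
        linear_combination hmn
      have h1 : (minpoly ℚ θ).natDegree = 1 := by
        rw [e, minpoly.eq_X_sub_C, natDegree_X_sub_C]
      rw [← hmin, (family_monic hh t).natDegree_map, family_natDegree hh] at h1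
      norm_num at h1
  · intro i j hij
    apply D.injective
    rw [← hσ i, ← hσ j]
    exact congrArg (fun f : K →+* ℝ => f θ) hij
  · intro φ
    have e := D.prod_eq (φ θ)
    simp only [Algebra.algebraMap_self, RingHom.id_apply] at e
    have e2 := congrArg φ hrootK
    simp only [map_add, map_sub, map_mul, map_pow, map_intCast, map_zero] at e2
    rw [e2, eq_comm, mul_eq_zero, mul_eq_zero, sub_eq_zero, sub_eq_zero, sub_eq_zero] at e
    have key : ∀ i, φ θ = x i → ((pb.lift (x i) (hlift i) : K →ₐ[ℚ] ℝ) : K →+* ℝ) = φ := by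
      intro i hi
      have : pb.lift (x i) (hlift i) = RingHom.toRatAlgHom φ := by
        apply pb.algHom_ext
        rw [pb.lift_gen, hgen]
        exact hi.symm
      rw [this]
      rfl
    rcases e with (e | e) | e
    · exact ⟨0, key 0 e⟩
    · exact ⟨1, key 1 e⟩
    · exact ⟨2, key 2 e⟩
  · convert D using 1
    funext i
    exact hσ i

end Family

section Units

variable {a b c d p q r t : ℤ} {B L : ℝ} {K : Type*} [Field K] {θ : K} {σ : Fin 3 → (K →+* ℝ)}

lemma OrderData.exists_coeffs (D : OrderData a b c d p q r t B L θ σ) {α : K}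
    (hα : α ∈ zAdjoin θ) : ∃ k m n : ℤ, α = k + m * θ + n * θ ^ 2 := by
  induction hα using Algebra.adjoin_induction with
  | mem x hx => exact ⟨0, 1, 0, by rw [Set.mem_singleton_iff.1 hx]; push_cast; ring⟩
  | algebraMap k => exact ⟨k, 0, 0, by simp⟩
  | add x y _ _ hx hy =>
    obtain ⟨k, m, n, rfl⟩ := hx
    obtain ⟨k', m', n', rfl⟩ := hy
    exact ⟨k + k', m + m', n + n', by push_cast; ring⟩
  | mul x y _ _ hx hy =>
    obtain ⟨k, m, n, rfl⟩ := hx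
    obtain ⟨k', m', n', rfl⟩ := hy
    have e : ∃ u v w : ℤ, θ ^ 3 = u + v * θ + w * θ ^ 2 :=
      ⟨-(r + t * (b * d)), -(q - t * (a * d + b * c)), -(p + t * (a * c)), by
        push_cast; linear_combination D.root⟩
    obtain ⟨u, v, w, e⟩ := e
    have e4 : θ ^ 4 = w * u + (u + w * v) * θ + (v + w * w) * θ ^ 2 := by
      linear_combination (θ + w) * e
    refine ⟨k * k' + (m * n' + n * m') * u + n * n' * (w * u),
      k * m' + m * k' + (m * n' + n * m') * v + n * n' * (u + w * v),
      k * n' + n * k' + m * m' + (m * n' + n * m') * w + n * n' * (v + w * w), ?_⟩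
    push_cast
    linear_combination (m * n' + n * m') * e + n * n' * e4

lemma theta_mem : θ ∈ zAdjoin θ := Algebra.self_mem_adjoin_singleton ℤ θ

lemma int_mem (n : ℤ) : (n : K) ∈ zAdjoin θ := intCast_mem _ n

lemma OrderData.symm_int (D : OrderData a b c d p q r t B L θ σ) : ∃ e1 e2 e3 : ℤ,
    σ 0 θ + σ 1 θ + σ 2 θ = e1 ∧ σ 0 θ * σ 1 θ + σ 0 θ * σ 2 θ + σ 1 θ * σ 2 θ = e2 ∧
      σ 0 θ * σ 1 θ * σ 2 θ = e3 :=
  ⟨-(p + t * (a * c)), q - t * (a * d + b * c), -(r + t * (b * d)), by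
    push_cast; exact D.data.e1, by push_cast; exact D.data.e2, by push_cast; exact D.data.e3⟩

lemma OrderData.exists_norm (D : OrderData a b c d p q r t B L θ σ) {α : K}
    (hα : α ∈ zAdjoin θ) : ∃ N : ℤ, σ 0 α * σ 1 α * σ 2 α = N := by
  obtain ⟨k, m, n, rfl⟩ := D.exists_coeffs hα
  obtain ⟨e1, e2, e3, h1, h2, h3⟩ := D.symm_int
  refine ⟨k ^ 3 + k ^ 2 * m * e1 + k ^ 2 * n * (e1 ^ 2 - 2 * e2) + k * m ^ 2 * e2 +
    k * m * n * (e1 * e2 - 3 * e3) + k * n ^ 2 * (e2 ^ 2 - 2 * e1 * e3) + m ^ 3 * e3 +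
    m ^ 2 * n * e1 * e3 + m * n ^ 2 * e2 * e3 + n ^ 3 * e3 ^ 2, ?_⟩
  push_cast
  rw [← h1, ← h2, ← h3]
  simp only [map_add, map_mul, map_pow, map_intCast]
  ring

lemma OrderData.disc_le (D : OrderData a b c d p q r t B L θ σ) {α : K}
    (hα : α ∈ zAdjoin θ) : (∃ k : ℤ, α = k) ∨
      Real.exp (2 * L - B) ≤ |(σ 0 α - σ 1 α) * (σ 0 α - σ 2 α) * (σ 1 α - σ 2 α)| := by
  obtain ⟨k, m, n, rfl⟩ := D.exists_coeffs hα
  by_cases hmn : m = 0 ∧ n = 0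
  · left; exact ⟨k, by simp [hmn.1, hmn.2]⟩
  right
  obtain ⟨e1, e2, e3, h1, h2, h3⟩ := D.symm_int
  have ne : ∀ i, (m + n * e1 : ℝ) - n * σ i θ ≠ 0 := by
    intro i hi
    have : σ i (((m + n * e1 : ℤ) : K) + ((-n : ℤ) : K) * θ) = 0 := by
      simp only [map_add, map_mul, map_intCast]; push_cast; linarith
    have h0 := D.irr _ _ ((map_eq_zero (σ i)).1 this)
    have hn : n = 0 := by simpa using h0.2
    apply hmn
    constructor
    · simpa [hn] using h0.1
    · exact hn
  obtain ⟨N, hN⟩ : ∃ N : ℤ, ((m + n * e1 : ℝ) - n * σ 0 θ) * ((m + n * e1 : ℝ) - n * σ 1 θ) *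
      ((m + n * e1 : ℝ) - n * σ 2 θ) = N := by
    refine ⟨(m + n * e1) ^ 3 - (m + n * e1) ^ 2 * n * e1 + (m + n * e1) * n ^ 2 * e2 -
      n ^ 3 * e3, ?_⟩
    push_cast
    rw [← h1, ← h2, ← h3]
    ring
  have hN1 : (1 : ℝ) ≤ |(N : ℝ)| := by
    have : N ≠ 0 := by
      rintro rfl
      rw [Int.cast_zero, mul_eq_zero, mul_eq_zero] at hN
      rcases hN with (h | h) | h
      exacts [ne 0 h, ne 1 h, ne 2 h]
    exact_mod_cast Int.one_le_abs this
  refine D.data.disc.trans ?_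
  refine (le_mul_of_one_le_right (abs_nonneg _) hN1).trans (le_of_eq ?_)
  rw [← abs_mul, ← hN, ← h1]
  congr 1
  simp only [map_add, map_mul, map_pow, map_intCast]
  ring

lemma unit_coe_ne_zero (ε : (zAdjoin θ)ˣ) : ((ε : zAdjoin θ) : K) ≠ 0 := by
  intro h
  have : ((ε : zAdjoin θ) : K) * ((ε⁻¹ : (zAdjoin θ)ˣ) : zAdjoin θ) = 1 := by
    rw [← Subalgebra.coe_mul, ← Units.val_mul, mul_inv_cancel, Units.val_one, Subalgebra.coe_one]
  rw [h, zero_mul] at this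
  exact zero_ne_one this

lemma OrderData.prod_unit (D : OrderData a b c d p q r t B L θ σ) (ε : (zAdjoin θ)ˣ) :
    |σ 0 ε * σ 1 ε * σ 2 ε| = 1 := by
  obtain ⟨N, hN⟩ := D.exists_norm (ε : zAdjoin θ).2
  obtain ⟨M, hM⟩ := D.exists_norm ((ε⁻¹ : (zAdjoin θ)ˣ) : zAdjoin θ).2
  have h : ((ε : zAdjoin θ) : K) * ((ε⁻¹ : (zAdjoin θ)ˣ) : zAdjoin θ) = 1 := by
    rw [← Subalgebra.coe_mul, ← Units.val_mul, mul_inv_cancel, Units.val_one, Subalgebra.coe_one]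
  have hi : ∀ i, σ i ((ε : zAdjoin θ) : K) * σ i ((ε⁻¹ : (zAdjoin θ)ˣ) : zAdjoin θ) = 1 :=
    fun i => by rw [← map_mul, h, map_one]
  have e : (N : ℝ) * M = 1 := by
    rw [← hN, ← hM]
    linear_combination (σ 1 ε * σ 1 (ε⁻¹ : (zAdjoin θ)ˣ) * (σ 2 ε * σ 2 (ε⁻¹ : (zAdjoin θ)ˣ))) * hi 0 +
      (σ 2 ε * σ 2 (ε⁻¹ : (zAdjoin θ)ˣ)) * hi 1 + hi 2
  have e' : N * M = 1 := by exact_mod_cast e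
  rw [hN]
  have := Int.isUnit_iff_abs_eq.1 (IsUnit.of_mul_eq_one _ e')
  exact_mod_cast this

/-- The logarithmic embedding of the units. -/
noncomputable def unitLog (σ : Fin 3 → (K →+* ℝ)) (ε : (zAdjoin θ)ˣ) (i : Fin 3) : ℝ :=
  Real.log |σ i ε|

lemma unitLog_mul (ε ε' : (zAdjoin θ)ˣ) (i : Fin 3) :
    unitLog σ (ε * ε') i = unitLog σ ε i + unitLog σ ε' i := by
  unfold unitLog
  rw [Units.val_mul, Subalgebra.coe_mul, map_mul, abs_mul, Real.log_mul]
  · exact abs_ne_zero.2 ((_root_.map_ne_zero _).2 (unit_coe_ne_zero _))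
  · exact abs_ne_zero.2 ((_root_.map_ne_zero _).2 (unit_coe_ne_zero _))

lemma unitLog_one (i : Fin 3) : unitLog σ (1 : (zAdjoin θ)ˣ) i = 0 := by
  simp [unitLog]

lemma unitLog_neg (ε : (zAdjoin θ)ˣ) (i : Fin 3) : unitLog σ (-ε) i = unitLog σ ε i := by
  simp [unitLog]

lemma unitLog_zpow (ε : (zAdjoin θ)ˣ) (n : ℤ) (i : Fin 3) :
    unitLog σ (ε ^ n) i = n * unitLog σ ε i := by
  let f : (zAdjoin θ)ˣ →* Multiplicative ℝ :=
    { toFun := fun ε => Multiplicative.ofAdd (unitLog σ ε i)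
      map_one' := by rw [unitLog_one]; rfl
      map_mul' := fun x y => by rw [unitLog_mul]; rfl }
  have := congrArg Multiplicative.toAdd (map_zpow f ε n)
  rw [toAdd_zpow, zsmul_eq_mul] at this
  exact this

lemma OrderData.sum_unitLog (D : OrderData a b c d p q r t B L θ σ) (ε : (zAdjoin θ)ˣ) :
    ∑ i, unitLog σ ε i = 0 := by
  have h := D.prod_unit ε
  have ne : ∀ i, |σ i ((ε : zAdjoin θ) : K)| ≠ 0 := fun i =>
    abs_ne_zero.2 ((_root_.map_ne_zero _).2 (unit_coe_ne_zero _))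
  rw [Fin.sum_univ_three]
  unfold unitLog
  rw [← Real.log_mul (ne 0) (ne 1), ← Real.log_mul (mul_ne_zero (ne 0) (ne 1)) (ne 2), ← abs_mul,
    ← abs_mul, h, Real.log_one]

lemma abs_sub_le_exp_max {x y : ℝ} (hx : x ≠ 0) (hy : y ≠ 0) :
    |x - y| ≤ 2 * Real.exp (max (Real.log |x|) (Real.log |y|)) := by
  have h1 : |x| ≤ Real.exp (max (Real.log |x|) (Real.log |y|)) := by
    rw [← Real.log_le_iff_le_exp (abs_pos.2 hx)]; exact le_max_left _ _
  have h2 : |y| ≤ Real.exp (max (Real.log |x|) (Real.log |y|)) := by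
    rw [← Real.log_le_iff_le_exp (abs_pos.2 hy)]; exact le_max_right _ _
  linarith [abs_sub x y]

lemma OrderData.eq_one_of_short (D : OrderData a b c d p q r t B L θ σ) (ε : (zAdjoin θ)ˣ)
    {R : ℝ} (hR : max (unitLog σ ε 0) (unitLog σ ε 1) + max (unitLog σ ε 0) (unitLog σ ε 2) +
      max (unitLog σ ε 1) (unitLog σ ε 2) ≤ R) (hRL : R + Real.log 8 < 2 * L - B) :
    ε = 1 ∨ ε = -1 := by
  rcases D.disc_le (ε : zAdjoin θ).2 with ⟨k, hk⟩ | h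
  · have h := D.prod_unit ε
    have h' : |(k * k * k : ℤ)| = 1 := by
      rw [hk] at h
      simp only [map_intCast] at h
      exact_mod_cast h
    have hk1 : IsUnit k := isUnit_of_mul_isUnit_right (Int.isUnit_iff_abs_eq.2 h')
    rcases Int.isUnit_iff.1 hk1 with rfl | rfl
    · left; ext; simpa using hk
    · right; ext; simpa using hk
  · exfalso
    have ne : ∀ i, σ i ((ε : zAdjoin θ) : K) ≠ 0 := fun i =>
      (_root_.map_ne_zero _).2 (unit_coe_ne_zero _)
    rw [abs_mul, abs_mul] at h
    have h2 := h.trans (mul_le_mul (mul_le_mul (abs_sub_le_exp_max (ne 0) (ne 1))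
      (abs_sub_le_exp_max (ne 0) (ne 2)) (abs_nonneg _) (by positivity))
      (abs_sub_le_exp_max (ne 1) (ne 2)) (abs_nonneg _) (by positivity))
    have e : ∀ x y z : ℝ, 2 * Real.exp x * (2 * Real.exp y) * (2 * Real.exp z) =
        Real.exp (x + y + z + Real.log 8) := fun x y z => by
      rw [Real.exp_add, Real.exp_add, Real.exp_add, Real.exp_log (by norm_num)]; ring
    rw [e, Real.exp_le_exp] at h2
    unfold unitLog at hR
    linarith

lemma exists_unit (hroot : θ ^ 3 + p * θ ^ 2 + q * θ + r + t * ((a * θ - b) * (c * θ - d)) = 0)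
    (h₁ : |b ^ 3 + p * a * b ^ 2 + q * a ^ 2 * b + r * a ^ 3| = 1) :
    ∃ u : (zAdjoin θ)ˣ, ((u : zAdjoin θ) : K) = a * θ - b := by
  have e := mul_cofactor hroot
  set N := b ^ 3 + p * a * b ^ 2 + q * a ^ 2 * b + r * a ^ 3
  set Q := ((a ^ 2 : ℤ) : K) * θ ^ 2 + ((a * b + p * a ^ 2 : ℤ) : K) * θ +
      ((b ^ 2 + p * a * b + q * a ^ 2 - a ^ 3 * t * d : ℤ) : K) + ((a ^ 3 * t * c : ℤ) : K) * θ
  have hQ : Q ∈ zAdjoin θ :=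
    add_mem (add_mem (add_mem (mul_mem (int_mem _) (pow_mem theta_mem 2))
      (mul_mem (int_mem _) theta_mem)) (int_mem _)) (mul_mem (int_mem _) theta_mem)
  have hu : (a : K) * θ - b ∈ zAdjoin θ := sub_mem (mul_mem (int_mem _) theta_mem) (int_mem _)
  have hN : N * N = 1 := by
    rw [← abs_mul_abs_self, h₁, mul_one]
  have hNK : ((N : ℤ) : K) * N = 1 := by rw [← Int.cast_mul, hN, Int.cast_one]
  refine ⟨Units.mkOfMulEqOne ⟨_, hu⟩ (⟨Q, hQ⟩ * ⟨((-N : ℤ) : K), int_mem _⟩) ?_, rfl⟩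
  ext
  push_cast at e ⊢
  linear_combination (-(N : K)) * e + hNK

lemma OrderData.hexApprox (D : OrderData a b c d p q r t B L θ σ) {u v : (zAdjoin θ)ˣ}
    (hu : ((u : zAdjoin θ) : K) = a * θ - b) (hv : ((v : zAdjoin θ) : K) = c * θ - d) :
    HexApprox B L (unitLog σ u) (unitLog σ v) := by
  convert D.data.hex using 2 with i
  · unfold unitLog; simp [hu]
  · unfold unitLog; simp [hv]

/-- For large `t` the units of `ℤ[θ]` are `± (a θ - b)^m (c θ - d)^n`. -/
lemma OrderData.exists_zpow (D : OrderData a b c d p q r t B L θ σ)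
    (hL : 8 * B + 2 * Real.log 8 < L) {u v : (zAdjoin θ)ˣ}
    (hu : ((u : zAdjoin θ) : K) = a * θ - b) (hv : ((v : zAdjoin θ) : K) = c * θ - d)
    (ε : (zAdjoin θ)ˣ) : ∃ m n : ℤ, ε = u ^ m * v ^ n ∨ ε = -(u ^ m * v ^ n) := by
  have hB := D.data.hex.nonneg
  have h8 : 0 < Real.log 8 := Real.log_pos (by norm_num)
  have H := D.hexApprox hu hv
  obtain ⟨x, y, hxy⟩ := H.exists_coord (by linarith) (unitLog σ ε) (D.sum_unitLog ε)
  have hs := H.sum_max_le (by linarith) (abs_sub_round x) (abs_sub_round y)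
    (w := unitLog σ (ε * (u ^ (-round x) * v ^ (-round y)))) (fun i => by
      rw [unitLog_mul, unitLog_mul, unitLog_zpow, unitLog_zpow, hxy]
      push_cast
      ring)
  have e : ε = (ε * (u ^ (-round x) * v ^ (-round y))) * (u ^ round x * v ^ round y) := by
    rw [mul_assoc, mul_mul_mul_comm, ← zpow_add, ← zpow_add]; simp
  refine ⟨round x, round y, ?_⟩
  rcases D.eq_one_of_short _ hs (by linarith) with h | h
  · left; rw [h, one_mul] at e; exact e
  · right; rw [h, neg_one_mul] at e; exact e

lemma closure_eq_top {u v : (zAdjoin θ)ˣ}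
    (h : ∀ ε : (zAdjoin θ)ˣ, ∃ m n : ℤ, ε = u ^ m * v ^ n ∨ ε = -(u ^ m * v ^ n)) :
    Subgroup.closure {u, v, -1} = ⊤ := by
  rw [eq_top_iff]
  intro ε _
  have hu : u ∈ Subgroup.closure {u, v, -1} := Subgroup.subset_closure (by simp)
  have hv : v ∈ Subgroup.closure {u, v, -1} := Subgroup.subset_closure (by simp)
  have hn : -1 ∈ Subgroup.closure {u, v, -1} := Subgroup.subset_closure (by simp)
  obtain ⟨m, n, rfl | rfl⟩ := h ε
  · exact mul_mem (zpow_mem hu _) (zpow_mem hv _)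
  · have := mul_mem hn (mul_mem (zpow_mem hu m) (zpow_mem hv n))
    rwa [neg_one_mul] at this

end Units

section Shape

/-- Points of the upper half plane are determined by the distances to `0` and `-1`. -/
lemma exists_norm_ball {N : Set UpperHalfPlane} (hN : N ∈ 𝓝 omega) :
    ∃ ε > 0, ∀ z : UpperHalfPlane, |‖(z : ℂ)‖ ^ 2 - 1| < ε → |‖(z : ℂ) + 1‖ ^ 2 - 1| < ε →
      z ∈ N := by
  let re : ℝ × ℝ → ℝ := fun x => (x.2 - x.1 - 1) / 2
  let F : ℝ × ℝ → ℂ := fun x => ((re x : ℝ) : ℂ) + (√(x.1 - re x ^ 2) : ℝ) * Complex.I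
  have hF : Continuous F := by fun_prop
  have hz : ∀ z : UpperHalfPlane, (z : ℂ) = F (‖(z : ℂ)‖ ^ 2, ‖(z : ℂ) + 1‖ ^ 2) := by
    intro z
    have hre : re (‖(z : ℂ)‖ ^ 2, ‖(z : ℂ) + 1‖ ^ 2) = (z : ℂ).re := by
      simp only [re, Complex.sq_norm, Complex.normSq_apply, Complex.add_re, Complex.add_im,
        Complex.one_re, Complex.one_im]
      ring
    have him : ‖(z : ℂ)‖ ^ 2 - (z : ℂ).re ^ 2 = (z : ℂ).im ^ 2 := by
      rw [Complex.sq_norm, Complex.normSq_apply]; ring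
    simp only [F, hre, him]
    rw [Real.sqrt_sq z.coe_im_pos.le, Complex.re_add_im]
  have hω : (omega : ℂ) = F (1, 1) := by
    have e : (omega : ℂ) = Complex.exp ((2 * Real.pi / 3 : ℝ) * Complex.I) := by
      change Complex.exp _ = _
      push_cast; rfl
    have e2 : 2 * Real.pi / 3 = Real.pi - Real.pi / 3 := by ring
    rw [e, Complex.exp_mul_I, ← Complex.ofReal_cos, ← Complex.ofReal_sin, e2, Real.cos_pi_sub,
      Real.sin_pi_sub, Real.cos_pi_div_three, Real.sin_pi_div_three]
    have h3 : √(1 - (-(1 / 2) : ℝ) ^ 2) = √3 / 2 := by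
      rw [show (1 - (-(1 / 2) : ℝ) ^ 2) = 3 / 2 ^ 2 by norm_num, Real.sqrt_div (by norm_num),
        Real.sqrt_sq (by norm_num)]
    have h4 : re (1, 1) = -(1 / 2) := by simp only [re]; norm_num
    simp only [F, h4, h3]
  rw [UpperHalfPlane.isEmbedding_coe.nhds_eq_comap, Filter.mem_comap] at hN
  obtain ⟨T, hT, hTN⟩ := hN
  rw [hω] at hT
  have h := hF.continuousAt.preimage_mem_nhds hT
  obtain ⟨ε, hε, hball⟩ := Metric.mem_nhds_iff.1 h
  refine ⟨ε, hε, fun z h1 h2 => hTN ?_⟩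
  rw [Set.mem_preimage, hz z]
  apply hball
  rw [Metric.mem_ball, Prod.dist_eq, max_lt_iff]
  exact ⟨h1, h2⟩

lemma tendsto_triangleShape {ι : Type*} {l : Filter ι} {s : ι → ModularSurface}
    (h : ∀ ε > 0, ∀ᶠ i in l, ∃ z : UpperHalfPlane, s i = ModularSurface.mk z ∧
      |‖(z : ℂ)‖ ^ 2 - 1| < ε ∧ |‖(z : ℂ) + 1‖ ^ 2 - 1| < ε) :
    Tendsto s l (𝓝 triangleShape) := by
  intro N hN
  have hc : Continuous ModularSurface.mk := continuous_quotient_mk'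
  obtain ⟨ε, hε, hz⟩ := exists_norm_ball (hc.continuousAt.preimage_mem_nhds hN)
  change ∀ᶠ i in l, s i ∈ N
  filter_upwards [h ε hε] with i ⟨z, hs, h1, h2⟩
  rw [hs]
  exact hz z h1 h2

lemma ModularSurface.mk_smul (g : Matrix.SpecialLinearGroup (Fin 2) ℤ) (z : UpperHalfPlane) :
    ModularSurface.mk (g • z) = ModularSurface.mk z :=
  Quotient.sound ⟨g, rfl⟩

local notation "E₃" => EuclideanSpace ℝ (Fin 3)

/-- The lattice spanned by two vectors. -/
def intSpan (U V : EuclideanSpace ℝ (Fin 3)) : Set (EuclideanSpace ℝ (Fin 3)) :=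
  {v | ∃ m n : ℤ, v = (m : ℝ) • U + (n : ℝ) • V}

lemma exists_smul_eq_div {z : UpperHalfPlane} {k l m n : ℤ} (h : k * n - l * m = 1) :
    ∃ g : Matrix.SpecialLinearGroup (Fin 2) ℤ,
      ((g • z : UpperHalfPlane) : ℂ) = (l + k * z) / (n + m * z) := by
  obtain ⟨g, hg⟩ : ∃ g : Matrix.SpecialLinearGroup (Fin 2) ℤ,
      (g : Matrix (Fin 2) (Fin 2) ℤ) = !![k, l; m, n] :=
    ⟨⟨!![k, l; m, n], by rw [Matrix.det_fin_two_of]; exact h⟩, rfl⟩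
  refine ⟨g, ?_⟩
  rw [UpperHalfPlane.coe_specialLinearGroup_apply, hg]
  simp [add_comm]

/-- A shape of a lattice in terms of the lengths of `U`, `V` and `V - U`, for a basis `U`, `V`. -/
lemma IsShapeOfLattice.exists_norms {U V : E₃} {s : ModularSurface}
    (hind : ∀ x y : ℝ, x • U + y • V = 0 → x = 0 ∧ y = 0)
    (h : IsShapeOfLattice (intSpan U V) s) : ∃ z : UpperHalfPlane, s = ModularSurface.mk z ∧
      ((‖(z : ℂ)‖ ^ 2 = ‖V‖ ^ 2 / ‖U‖ ^ 2 ∧ ‖(z : ℂ) + 1‖ ^ 2 = ‖V - U‖ ^ 2 / ‖U‖ ^ 2) ∨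
        (‖(z : ℂ)‖ ^ 2 = ‖U‖ ^ 2 / ‖V‖ ^ 2 ∧ ‖(z : ℂ) + 1‖ ^ 2 = ‖V - U‖ ^ 2 / ‖V‖ ^ 2)) := by
  obtain ⟨f, r, z, hr, hnorm, -, himg, rfl⟩ := h
  have hinj : ∀ w : ℂ, f w = 0 → w = 0 := by
    intro w hw
    have := hnorm w
    rw [hw, norm_zero, eq_comm, mul_eq_zero] at this
    simpa using this.resolve_left hr.ne'
  have hreal : ∀ x y : ℝ, (x + y * z : ℂ) = 0 → x = 0 ∧ y = 0 := by
    intro x y hxy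
    have him := congrArg Complex.im hxy
    simp only [Complex.add_im, Complex.ofReal_im, Complex.im_ofReal_mul,
      zero_add, Complex.zero_im] at him
    have hy := (mul_eq_zero.1 him).resolve_right z.im_pos.ne'
    subst hy
    exact ⟨by simpa using hxy, rfl⟩
  have hU : -U ∈ intSpan U V := ⟨-1, 0, by simp⟩
  have hV : V ∈ intSpan U V := ⟨0, 1, by simp⟩
  rw [← himg] at hU hV
  obtain ⟨w₁, ⟨m₁, n₁, hw₁⟩, hfU⟩ := hU
  obtain ⟨w₂, ⟨m₂, n₂, hw₂⟩, hfV⟩ := hV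
  have back : ∀ w : ℂ, w ∈ {w : ℂ | ∃ m n : ℤ, w = m + n * (z : ℂ)} →
      ∃ α β : ℤ, w = α * w₁ + β * w₂ := by
    intro w hw
    have : f w ∈ intSpan U V := by rw [← himg]; exact ⟨w, hw, rfl⟩
    obtain ⟨α, β, hαβ⟩ := this
    refine ⟨-α, β, ?_⟩
    rw [← sub_eq_zero]
    apply hinj
    have e : (((-α : ℤ) : ℂ) * w₁ + (β : ℂ) * w₂) = (-α : ℝ) • w₁ + (β : ℝ) • w₂ := by
      simp
    rw [map_sub, e, map_add, map_smul, map_smul, hfU, hfV, hαβ]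
    simp
  obtain ⟨α, β, h1⟩ := back 1 ⟨1, 0, by simp⟩
  obtain ⟨γ, δ, h2⟩ := back z ⟨0, 1, by simp⟩
  have q1 := hreal (α * m₁ + β * m₂ - 1) (α * n₁ + β * n₂) (by
    push_cast; rw [hw₁, hw₂] at h1; linear_combination -h1)
  have q2 := hreal (γ * m₁ + δ * m₂) (γ * n₁ + δ * n₂ - 1) (by
    push_cast; rw [hw₁, hw₂] at h2; linear_combination -h2)
  have i1 : α * m₁ + β * m₂ - 1 = 0 := by exact_mod_cast q1.1
  have i2 : α * n₁ + β * n₂ = 0 := by exact_mod_cast q1.2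
  have i3 : γ * m₁ + δ * m₂ = 0 := by exact_mod_cast q2.1
  have i4 : γ * n₁ + δ * n₂ - 1 = 0 := by exact_mod_cast q2.2
  have hdet : (m₁ * n₂ - m₂ * n₁) * (α * δ - β * γ) = 1 := by
    linear_combination (γ * n₁ + δ * n₂) * i1 + i4 - (γ * m₁ + δ * m₂) * i2
  have hUpos : U ≠ 0 := by
    rintro rfl
    exact one_ne_zero (hind 1 0 (by simp)).1
  have hVpos : V ≠ 0 := by
    rintro rfl
    exact one_ne_zero (hind 0 1 (by simp)).2
  have n1 : r * ‖w₁‖ = ‖U‖ := by rw [← hnorm, hfU, norm_neg]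
  have n2 : r * ‖w₂‖ = ‖V‖ := by rw [← hnorm, hfV]
  have n3 : r * ‖w₁ + w₂‖ = ‖V - U‖ := by rw [← hnorm, map_add, hfU, hfV, neg_add_eq_sub]
  have w1ne : w₁ ≠ 0 := by
    rintro rfl
    rw [norm_zero, mul_zero] at n1
    exact hUpos (norm_eq_zero.1 n1.symm)
  have w2ne : w₂ ≠ 0 := by
    rintro rfl
    rw [norm_zero, mul_zero] at n2
    exact hVpos (norm_eq_zero.1 n2.symm)
  have k1 := norm_ne_zero_iff.2 w1ne
  have k2 := norm_ne_zero_iff.2 w2ne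
  rcases Int.isUnit_iff.1 (IsUnit.of_mul_eq_one _ hdet) with hd | hd
  · obtain ⟨g, hg⟩ := exists_smul_eq_div (z := z) (k := n₂) (l := m₂) (m := n₁) (n := m₁)
      (by linear_combination hd)
    rw [← hw₁, ← hw₂] at hg
    refine ⟨g • z, (ModularSurface.mk_smul g z).symm, Or.inl ⟨?_, ?_⟩⟩
    · rw [hg, norm_div, ← n1, ← n2]; field_simp
    · rw [hg, div_add_one w1ne, norm_div, ← n1, ← n3, add_comm w₂]; field_simp
  · obtain ⟨g, hg⟩ := exists_smul_eq_div (z := z) (k := n₁) (l := m₁) (m := n₂) (n := m₂)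
      (by linear_combination -hd)
    rw [← hw₁, ← hw₂] at hg
    refine ⟨g • z, (ModularSurface.mk_smul g z).symm, Or.inr ⟨?_, ?_⟩⟩
    · rw [hg, norm_div, ← n1, ← n2]; field_simp
    · rw [hg, div_add_one w2ne, norm_div, ← n2, ← n3]; field_simp

/-- A lattice in the plane `x₁ + x₂ + x₃ = 0` has a shape. -/
lemma exists_isShapeOfLattice {U V : E₃}
    (hind : ∀ x y : ℝ, x • U + y • V = 0 → x = 0 ∧ y = 0) (hU : ∑ i, U i = 0)
    (hV : ∑ i, V i = 0) : ∃ s, IsShapeOfLattice (intSpan U V) s := by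
  have hU0 : U ≠ 0 := by
    rintro rfl
    exact one_ne_zero (hind 1 0 (by simp)).1
  have hpos : 0 < ‖U‖ := norm_pos_iff.2 hU0
  set W : E₃ := WithLp.toLp 2 ![(U 1 - U 2) / √3, (U 2 - U 0) / √3, (U 0 - U 1) / √3] with hW
  have W0 : W 0 = (U 1 - U 2) / √3 := rfl
  have W1 : W 1 = (U 2 - U 0) / √3 := rfl
  have W2 : W 2 = (U 0 - U 1) / √3 := rfl
  have s3 : √3 ^ 2 = 3 := Real.sq_sqrt (by norm_num)
  have s3' : √3 ≠ 0 := by positivity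
  rw [Fin.sum_univ_three] at hU
  have hUs : ‖U‖ ^ 2 = U 0 ^ 2 + U 1 ^ 2 + U 2 ^ 2 := by
    rw [EuclideanSpace.real_norm_sq_eq, Fin.sum_univ_three]
  have hU2 : U 2 = -U 0 - U 1 := by linarith
  set f : ℂ →ₗ[ℝ] E₃ := Complex.reLm.smulRight U + Complex.imLm.smulRight W with hf
  have hfa : ∀ w, f w = w.re • U + w.im • W := fun w => rfl
  have hfn : ∀ w : ℂ, ‖f w‖ = ‖U‖ * ‖w‖ := by
    intro w
    rw [← sq_eq_sq₀ (norm_nonneg _) (by positivity), mul_pow, hUs, Complex.sq_norm,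
      Complex.normSq_apply, hfa, EuclideanSpace.real_norm_sq_eq, Fin.sum_univ_three]
    simp only [PiLp.add_apply, PiLp.smul_apply, smul_eq_mul, W0, W1, W2]
    rw [hU2]
    field_simp
    rw [s3]
    linear_combination 2 * w.re ^ 2 * (U 0 * U 1 + U 0 ^ 2 + U 1 ^ 2) * s3
  have hrange : Set.range f = {x | ∑ i, x i = 0} := by
    ext x
    constructor
    · rintro ⟨w, rfl⟩
      rw [Set.mem_ofPred_eq, hfa, Fin.sum_univ_three]
      simp only [PiLp.add_apply, PiLp.smul_apply, smul_eq_mul, W0, W1, W2]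
      rw [hU2]
      field_simp
      ring
    · intro hx
      rw [Set.mem_ofPred_eq, Fin.sum_univ_three] at hx
      have hx2 : x 2 = -x 0 - x 1 := by linarith
      have hne : U 0 ^ 2 + U 1 ^ 2 + U 2 ^ 2 ≠ 0 := by rw [← hUs]; positivity
      rw [hU2] at hne
      obtain ⟨D, hD⟩ : ∃ D, D = U 0 ^ 2 + U 0 * U 1 + U 1 ^ 2 := ⟨_, rfl⟩
      have hne' : D ≠ 0 := by
        intro h; apply hne; linear_combination 2 * h - 2 * hD
      refine ⟨⟨(x 0 * U 0 + x 1 * U 1 + x 2 * U 2) / (2 * D),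
        (x 0 * W 0 + x 1 * W 1 + x 2 * W 2) / (2 * D)⟩, ?_⟩
      rw [hfa]
      ext i
      simp only [PiLp.add_apply, PiLp.smul_apply, smul_eq_mul]
      fin_cases i
      · simp only [Fin.zero_eta, W0, W1, W2]
        rw [hU2, hx2]; field_simp; rw [s3, hD]; ring
      · simp only [Fin.mk_one, W0, W1, W2]
        rw [hU2, hx2]; field_simp; rw [s3, hD]; ring
      · simp only [Fin.reduceFinMk, W0, W1, W2]
        rw [hU2, hx2]; field_simp; rw [s3, hD]; ring
  obtain ⟨z, hz⟩ : V ∈ Set.range f := by rw [hrange]; exact hV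
  have h1 : f 1 = U := by rw [hfa]; simp
  have hzim : z.im ≠ 0 := by
    intro h
    rw [hfa, h, zero_smul, add_zero] at hz
    have := hind z.re (-1) (by rw [hz]; simp)
    norm_num at this
  have hcomb : ∀ m n : ℤ, f (m + n * z) = (m : ℝ) • U + (n : ℝ) • V := by
    intro m n
    have e : (m + n * z : ℂ) = (m : ℝ) • (1 : ℂ) + (n : ℝ) • z := by simp
    rw [e, map_add, map_smul, map_smul, h1, hz]
  rcases lt_or_gt_of_ne hzim with h | h
  · refine ⟨ModularSurface.mk ⟨-z, by simpa using h⟩, f, ‖U‖, ⟨-z, by simpa using h⟩, hpos, hfn,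
      hrange, ?_, rfl⟩
    ext v
    constructor
    · rintro ⟨w, ⟨m, n, rfl⟩, rfl⟩
      refine ⟨m, -n, ?_⟩
      rw [← hcomb]
      congr 1
      push_cast
      ring
    · rintro ⟨m, n, rfl⟩
      refine ⟨_, ⟨m, -n, rfl⟩, ?_⟩
      rw [← hcomb]
      congr 1
      push_cast
      change (m : ℂ) + -n * (-z) = _
      ring
  · refine ⟨ModularSurface.mk ⟨z, h⟩, f, ‖U‖, ⟨z, h⟩, hpos, hfn, hrange, ?_, rfl⟩
    ext v
    constructor
    · rintro ⟨w, ⟨m, n, rfl⟩, rfl⟩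
      exact ⟨m, n, hcomb m n⟩
    · rintro ⟨m, n, rfl⟩
      exact ⟨_, ⟨m, n, rfl⟩, hcomb m n⟩

lemma abs_sq_sub_sq_le {x L C : ℝ} (hL : 0 ≤ L) (h : |x - L| ≤ C ∨ |x + L| ≤ C) :
    |x ^ 2 - L ^ 2| ≤ C * (2 * L + C) := by
  have e : x ^ 2 - L ^ 2 = (x - L) * (x + L) := by ring
  rw [e, abs_mul]
  have hC : 0 ≤ C := by rcases h with h | h <;> exact (abs_nonneg _).trans h
  rcases h with h | h
  · refine mul_le_mul h ?_ (abs_nonneg _) hC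
    rw [abs_le] at h ⊢; constructor <;> linarith
  · rw [mul_comm]
    refine mul_le_mul h ?_ (abs_nonneg _) hC
    rw [abs_le] at h ⊢; constructor <;> linarith

lemma abs_sum_sq_sub_le {x y z L C : ℝ} (hL : 0 ≤ L) (hx : |x - L| ≤ C ∨ |x + L| ≤ C)
    (hy : |y - L| ≤ C ∨ |y + L| ≤ C) (hz : |z| ≤ C) :
    |x ^ 2 + y ^ 2 + z ^ 2 - 2 * L ^ 2| ≤ 4 * C * L + 3 * C ^ 2 := by
  have h1 := abs_le.1 (abs_sq_sub_sq_le hL hx)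
  have h2 := abs_le.1 (abs_sq_sub_sq_le hL hy)
  have h3 : z ^ 2 ≤ C ^ 2 := by
    rw [← sq_abs z]; exact pow_le_pow_left₀ (abs_nonneg _) hz 2
  have h4 := sq_nonneg z
  rw [abs_le]; constructor <;> linarith

lemma abs_div_sub_one_lt {X Y L M ε : ℝ} (hε : 0 < ε) (hL : 0 < L) (hX : |X - 2 * L ^ 2| ≤ M * L)
    (hY : |Y - 2 * L ^ 2| ≤ M * L) (hLM : M + 2 * M / ε < 2 * L) : |X / Y - 1| < ε := by
  rw [abs_le] at hX hY
  have hM : 0 ≤ M := by nlinarith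
  have hd : 0 ≤ 2 * M / ε := by positivity
  have hYpos : 0 < Y := by nlinarith
  rw [div_sub_one hYpos.ne', abs_div, abs_of_pos hYpos, div_lt_iff₀ hYpos]
  have h1 : |X - Y| ≤ 2 * M * L := by rw [abs_le]; constructor <;> linarith
  have h2 : 2 * M < ε * (2 * L - M) := by
    rw [← div_lt_iff₀' hε]; linarith
  have h3 : ε * (2 * L ^ 2 - M * L) ≤ ε * Y := by gcongr; linarith
  nlinarith

/-- The square lengths of `U`, `V` and `V - U` are asymptotically equal. -/
lemma HexApprox.norms {C L : ℝ} {U V : Fin 3 → ℝ} (H : HexApprox C L U V) (hL : 1 ≤ L) :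
    |∑ i, U i ^ 2 - 2 * L ^ 2| ≤ (8 * C + 12 * C ^ 2) * L ∧
    |∑ i, V i ^ 2 - 2 * L ^ 2| ≤ (8 * C + 12 * C ^ 2) * L ∧
    |∑ i, (V i - U i) ^ 2 - 2 * L ^ 2| ≤ (8 * C + 12 * C ^ 2) * L := by
  have hC := H.nonneg
  have hL0 : 0 ≤ L := by linarith
  have hC2 : C ^ 2 ≤ C ^ 2 * L := le_mul_of_one_le_right (sq_nonneg _) hL
  have hCL : 0 ≤ C * L := mul_nonneg hC hL0
  simp only [Fin.sum_univ_three]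
  have u0 := abs_le.1 H.u0
  have u1 := abs_le.1 H.u1
  have u2 := abs_le.1 H.u2
  have v0 := abs_le.1 H.v0
  have v1 := abs_le.1 H.v1
  have v2 := abs_le.1 H.v2
  refine ⟨?_, ?_, ?_⟩
  · have := abs_sum_sq_sub_le hL0 (Or.inr H.u0) (Or.inl H.u2) H.u1
    rw [add_right_comm] at this
    refine this.trans ?_
    nlinarith
  · have := abs_sum_sq_sub_le hL0 (Or.inr H.v1) (Or.inl H.v2) H.v0
    rw [add_comm, ← add_assoc] at this
    refine this.trans ?_
    nlinarith
  · have := abs_sum_sq_sub_le (C := 2 * C) (x := V 0 - U 0) (y := V 1 - U 1) (z := V 2 - U 2) hL0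
      (Or.inl (abs_le.2 ⟨by linarith, by linarith⟩))
      (Or.inr (abs_le.2 ⟨by linarith, by linarith⟩)) (abs_le.2 ⟨by linarith, by linarith⟩)
    refine this.trans ?_
    nlinarith

end Shape

section UnitShape

variable {a b c d p q r t : ℤ} {B L : ℝ} {K : Type*} [Field K] {θ : K} {σ σ' : Fin 3 → (K →+* ℝ)}

lemma OrderData.exists_perm (D : OrderData a b c d p q r t B L θ σ) (h : Function.Bijective σ') :
    ∃ π : Equiv.Perm (Fin 3), ∀ i, σ' (π i) = σ i :=
  ⟨(Equiv.ofBijective σ D.bij).trans (Equiv.ofBijective σ' h).symm, fun i =>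
    Equiv.ofBijective_apply_symm_apply σ' h (σ i)⟩

lemma logVec_unit (ε : (zAdjoin θ)ˣ) (i : Fin 3) :
    logVec σ ((ε : zAdjoin θ) : K) i = unitLog σ ε i := rfl

lemma sum_logVec_perm {π : Equiv.Perm (Fin 3)} (hπ : ∀ i, σ' (π i) = σ i) (f : ℝ → ℝ → ℝ)
    (u v : (zAdjoin θ)ˣ) : ∑ i, f (unitLog σ' u i) (unitLog σ' v i) =
      ∑ i, f (unitLog σ u i) (unitLog σ v i) := by
  rw [← Equiv.sum_comp π]
  simp only [unitLog, hπ]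

lemma unitLattice_eq {u v : (zAdjoin θ)ˣ}
    (h : ∀ ε : (zAdjoin θ)ˣ, ∃ m n : ℤ, ε = u ^ m * v ^ n ∨ ε = -(u ^ m * v ^ n)) :
    unitLattice σ (zAdjoin θ) = intSpan (logVec σ (u : zAdjoin θ)) (logVec σ (v : zAdjoin θ)) := by
  have key : ∀ m n : ℤ, logVec σ ((u ^ m * v ^ n : (zAdjoin θ)ˣ) : zAdjoin θ) =
      (m : ℝ) • logVec σ (u : zAdjoin θ) + (n : ℝ) • logVec σ (v : zAdjoin θ) := by
    intro m n
    ext i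
    simp only [PiLp.add_apply, PiLp.smul_apply, smul_eq_mul, logVec_unit, unitLog_mul,
      unitLog_zpow]
  ext w
  constructor
  · rintro ⟨ε, rfl⟩
    obtain ⟨m, n, hε⟩ := h ε
    refine ⟨m, n, ?_⟩
    rw [← key]
    ext i
    rw [logVec_unit, logVec_unit]
    rcases hε with rfl | rfl
    · rfl
    · rw [unitLog_neg]
  · rintro ⟨m, n, rfl⟩
    exact ⟨u ^ m * v ^ n, (key m n).symm⟩

lemma HexApprox.logVec_indep {u v : (zAdjoin θ)ˣ} (H : HexApprox B L (unitLog σ u) (unitLog σ v))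
    (hL : 2 * B < L) {π : Equiv.Perm (Fin 3)} (hπ : ∀ i, σ' (π i) = σ i) (x y : ℝ)
    (h : x • logVec σ' (u : zAdjoin θ) + y • logVec σ' (v : zAdjoin θ) = 0) : x = 0 ∧ y = 0 := by
  apply H.coord_unique hL
  intro i
  have := congrArg (fun w : EuclideanSpace ℝ (Fin 3) => w (π i)) h
  simpa only [PiLp.add_apply, PiLp.smul_apply, smul_eq_mul, logVec_unit, unitLog, hπ,
    PiLp.zero_apply] using this

lemma OrderData.exists_isUnitShape (D : OrderData a b c d p q r t B L θ σ) (hL : 2 * B < L)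
    {u v : (zAdjoin θ)ˣ} (H : HexApprox B L (unitLog σ u) (unitLog σ v))
    (h : ∀ ε : (zAdjoin θ)ˣ, ∃ m n : ℤ, ε = u ^ m * v ^ n ∨ ε = -(u ^ m * v ^ n)) :
    ∃ s, IsUnitShape (zAdjoin θ) s := by
  obtain ⟨s, hs⟩ := exists_isShapeOfLattice
    (H.logVec_indep hL (π := Equiv.refl _) (fun i => rfl)) H.sum_u H.sum_v
  exact ⟨s, σ, D.bij, by rwa [unitLattice_eq h]⟩

lemma OrderData.isUnitShape_near (D : OrderData a b c d p q r t B L θ σ) (hL : 2 * B < L)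
    {u v : (zAdjoin θ)ˣ} (H : HexApprox B L (unitLog σ u) (unitLog σ v))
    (h : ∀ ε : (zAdjoin θ)ˣ, ∃ m n : ℤ, ε = u ^ m * v ^ n ∨ ε = -(u ^ m * v ^ n)) {ε : ℝ}
    (hε : 0 < ε) (hL1 : 1 ≤ L) (hLε : 8 * B + 12 * B ^ 2 + 2 * (8 * B + 12 * B ^ 2) / ε < 2 * L)
    {s : ModularSurface} (hs : IsUnitShape (zAdjoin θ) s) :
    ∃ z : UpperHalfPlane, s = ModularSurface.mk z ∧
      |‖(z : ℂ)‖ ^ 2 - 1| < ε ∧ |‖(z : ℂ) + 1‖ ^ 2 - 1| < ε := by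
  obtain ⟨σ', hbij, hs⟩ := hs
  obtain ⟨π, hπ⟩ := D.exists_perm hbij
  rw [unitLattice_eq h] at hs
  obtain ⟨z, hz, hn⟩ := hs.exists_norms (H.logVec_indep hL hπ)
  obtain ⟨hU, hV, hW⟩ := H.norms hL1
  rw [EuclideanSpace.real_norm_sq_eq, EuclideanSpace.real_norm_sq_eq,
    EuclideanSpace.real_norm_sq_eq] at hn
  simp only [PiLp.sub_apply, logVec_unit] at hn
  rw [sum_logVec_perm hπ (fun x _ => x ^ 2) u v, sum_logVec_perm hπ (fun _ x => x ^ 2) u v,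
    sum_logVec_perm hπ (fun x y => (y - x) ^ 2) u v] at hn
  have hL0 : 0 < L := by linarith
  refine ⟨z, hz, ?_⟩
  rcases hn with ⟨h1, h2⟩ | ⟨h1, h2⟩ <;> rw [h1, h2]
  · exact ⟨abs_div_sub_one_lt hε hL0 hV hU hLε, abs_div_sub_one_lt hε hL0 hW hU hLε⟩
  · exact ⟨abs_div_sub_one_lt hε hL0 hU hV hLε, abs_div_sub_one_lt hε hL0 hW hV hLε⟩

end UnitShape

section LatticeSpaceTopology

lemma LatticeSpace.isOpenQuotientMap_mk : IsOpenQuotientMap LatticeSpace.mk :=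
  QuotientGroup.isOpenQuotientMap_mk

lemma LatticeSpace.mk_eq_mk {g g' : SL3R} :
    LatticeSpace.mk g = LatticeSpace.mk g' ↔ g⁻¹ * g' ∈ SL3Z :=
  QuotientGroup.eq

lemma LatticeSpace.smul_mk (c : diagGroup) (g : SL3R) :
    c • LatticeSpace.mk g = LatticeSpace.mk ((c : SL3R) * g) := rfl

lemma LatticeSpace.continuous_smul :
    Continuous fun x : SL3R × LatticeSpace => x.1 • x.2 :=
  ContinuousSMul.continuous_smul (M := SL3R) (X := SL3R ⧸ SL3Z)

lemma continuous_entry (i j : Fin 3) : Continuous fun g : SL3R => (g : Matrix (Fin 3) (Fin 3) ℝ) i j :=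
  continuous_subtype_val.matrix_elem i j

lemma mem_SL3Z_iff {g : SL3R} :
    g ∈ SL3Z ↔ ∀ i j, (g : Matrix (Fin 3) (Fin 3) ℝ) i j ∈ Set.range (Int.cast : ℤ → ℝ) := by
  constructor
  · rintro ⟨γ, rfl⟩ i j
    exact ⟨(γ : Matrix (Fin 3) (Fin 3) ℤ) i j, rfl⟩
  · intro h
    choose A hA using h
    have e : (Int.castRingHom ℝ).mapMatrix (Matrix.of A) = (g : Matrix (Fin 3) (Fin 3) ℝ) := by
      ext i j; exact hA i j
    have hdet : (Matrix.of A).det = 1 := by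
      have := congrArg Matrix.det e
      rw [← RingHom.map_det, Matrix.SpecialLinearGroup.det_coe, eq_intCast] at this
      exact_mod_cast this
    exact ⟨⟨Matrix.of A, hdet⟩, Subtype.ext e⟩

lemma isClosed_SL3Z : IsClosed (SL3Z : Set SL3R) := by
  have : (SL3Z : Set SL3R) = ⋂ i, ⋂ j, (fun g : SL3R => (g : Matrix (Fin 3) (Fin 3) ℝ) i j) ⁻¹'
      Set.range (Int.cast : ℤ → ℝ) := by
    ext g
    simp only [SetLike.mem_coe, mem_SL3Z_iff, Set.mem_iInter, Set.mem_preimage]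
  rw [this]
  exact isClosed_iInter fun i => isClosed_iInter fun j =>
    Int.isClosedEmbedding_coe_real.isClosed_range.preimage (continuous_entry i j)

instance : T2Space LatticeSpace := by
  rw [t2Space_iff_of_isOpenQuotientMap LatticeSpace.isOpenQuotientMap_mk]
  simp only [LatticeSpace.mk_eq_mk]
  exact isClosed_SL3Z.preimage (by fun_prop : Continuous fun q : SL3R × SL3R => q.1⁻¹ * q.2)

/-- The lattices `g ℤ³` for which the entries of `g⁻¹` are less than `M`. -/
def thickPart (M : ℝ) : Set LatticeSpace :=
  LatticeSpace.mk '' {g | ∀ i j, |((g⁻¹ : SL3R) : Matrix (Fin 3) (Fin 3) ℝ) i j| < M}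

lemma isOpen_thickPart (M : ℝ) : IsOpen (thickPart M) := by
  apply LatticeSpace.isOpenQuotientMap_mk.isOpenMap
  simp only [Set.ofPred_forall]
  refine isOpen_iInter_of_finite fun i => isOpen_iInter_of_finite fun j => ?_
  exact isOpen_lt ((continuous_entry i j).comp continuous_inv).abs continuous_const

lemma exists_subset_thickPart {S : Set LatticeSpace} (hS : IsCompact S) :
    ∃ M : ℝ, 1 ≤ M ∧ S ⊆ thickPart M := by
  obtain ⟨n, hn⟩ := hS.elim_directed_cover (fun n : ℕ => thickPart (n : ℝ))
    (fun n => isOpen_thickPart _) (fun x _ => by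
      obtain ⟨g, rfl⟩ := LatticeSpace.isOpenQuotientMap_mk.surjective x
      obtain ⟨n, hn⟩ := exists_nat_gt (∑ i, ∑ j, |((g⁻¹ : SL3R) : Matrix (Fin 3) (Fin 3) ℝ) i j|)
      refine Set.mem_iUnion.2 ⟨n, g, fun i j => lt_of_le_of_lt ?_ hn, rfl⟩
      refine le_trans ?_ (Finset.single_le_sum
        (f := fun i => ∑ j, |((g⁻¹ : SL3R) : Matrix (Fin 3) (Fin 3) ℝ) i j|)
        (fun i _ => Finset.sum_nonneg fun j _ => abs_nonneg _) (Finset.mem_univ i))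
      exact Finset.single_le_sum (f := fun j => |((g⁻¹ : SL3R) : Matrix (Fin 3) (Fin 3) ℝ) i j|)
        (fun j _ => abs_nonneg _) (Finset.mem_univ j))
    (directed_of_isDirected_le fun m n hmn => by
      rintro _ ⟨g, hg, rfl⟩
      exact ⟨g, fun i j => (hg i j).trans_le (by exact_mod_cast hmn), rfl⟩)
  refine ⟨n + 1, by simp, hn.trans ?_⟩
  rintro _ ⟨g, hg, rfl⟩
  exact ⟨g, fun i j => (hg i j).trans (by simp), rfl⟩

/-- Nonzero vectors of the lattices in `thickPart M` are not short. -/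
lemma exists_le_of_mem_thickPart {M : ℝ} (hM : 1 ≤ M) {g : SL3R}
    (hg : LatticeSpace.mk g ∈ thickPart M) {n : Fin 3 → ℤ} (hn : n ≠ 0) :
    ∃ i, 1 / (3 * M) ≤ |(g : Matrix (Fin 3) (Fin 3) ℝ).mulVec (fun j => (n j : ℝ)) i| := by
  obtain ⟨g', hg', e⟩ := hg
  rw [LatticeSpace.mk_eq_mk] at e
  obtain ⟨γ, hγ⟩ := e
  set w := (g : Matrix (Fin 3) (Fin 3) ℝ).mulVec (fun j => (n j : ℝ)) with hw
  set k := (γ : Matrix (Fin 3) (Fin 3) ℤ).mulVec n with hk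
  have hk0 : k ≠ 0 := by
    intro h
    apply hn
    have := congrArg ((γ⁻¹ : Matrix.SpecialLinearGroup (Fin 3) ℤ) : Matrix (Fin 3) (Fin 3) ℤ).mulVec h
    rw [hk, Matrix.mulVec_mulVec, ← Matrix.SpecialLinearGroup.coe_mul, inv_mul_cancel,
      Matrix.SpecialLinearGroup.coe_one, Matrix.one_mulVec, Matrix.mulVec_zero] at this
    exact this
  have hkw : ∀ i, (k i : ℝ) = ∑ j, ((g'⁻¹ : SL3R) : Matrix (Fin 3) (Fin 3) ℝ) i j * w j := by
    intro i
    change _ = ((g'⁻¹ : SL3R) : Matrix (Fin 3) (Fin 3) ℝ).mulVec w i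
    rw [hw, Matrix.mulVec_mulVec, ← Matrix.SpecialLinearGroup.coe_mul, ← hγ, hk]
    simp only [Matrix.mulVec, dotProduct]
    push_cast
    rfl
  obtain ⟨i, hi⟩ := Function.ne_iff.1 hk0
  have h1 : (1 : ℝ) ≤ |(k i : ℝ)| := by exact_mod_cast Int.one_le_abs hi
  by_contra! hcon
  rw [hkw] at h1
  have h2 : |∑ j, ((g'⁻¹ : SL3R) : Matrix (Fin 3) (Fin 3) ℝ) i j * w j| < ∑ j : Fin 3, M * (1 / (3 * M)) := by
    refine (Finset.abs_sum_le_sum_abs _ _).trans_lt (Finset.sum_lt_sum_of_nonempty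
      Finset.univ_nonempty fun j _ => ?_)
    rw [abs_mul]
    exact mul_lt_mul' (hg' i j).le (hcon j) (abs_nonneg _) (by linarith)
  have h3 : ∑ j : Fin 3, M * (1 / (3 * M)) = 1 := by
    rw [Fin.sum_const, nsmul_eq_mul]; push_cast; field_simp
  linarith

end LatticeSpaceTopology

section Diag

/-- The diagonal matrix with entries `exp (w i)`. -/
noncomputable def expDiag (w : Fin 3 → ℝ) (hw : ∑ i, w i = 0) : diagGroup :=
  ⟨⟨Matrix.diagonal fun i => Real.exp (w i), by
    rw [Matrix.det_diagonal, ← Real.exp_sum, hw, Real.exp_zero]⟩,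
    ⟨fun i => Real.exp (w i), fun i => Real.exp_pos _, rfl⟩⟩

lemma coe_expDiag (w : Fin 3 → ℝ) (hw : ∑ i, w i = 0) :
    ((expDiag w hw : SL3R) : Matrix (Fin 3) (Fin 3) ℝ) = Matrix.diagonal fun i => Real.exp (w i) := rfl

lemma expDiag_mul {w w' w'' : Fin 3 → ℝ} (hw : ∑ i, w i = 0) (hw' : ∑ i, w' i = 0)
    (hw'' : ∑ i, w'' i = 0) (h : ∀ i, w'' i = w i + w' i) :
    expDiag w hw * expDiag w' hw' = expDiag w'' hw'' := by
  apply Subtype.ext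
  apply Subtype.ext
  change ((expDiag w hw : SL3R) : Matrix (Fin 3) (Fin 3) ℝ) * ((expDiag w' hw' : SL3R) : Matrix (Fin 3) (Fin 3) ℝ) =
    ((expDiag w'' hw'' : SL3R) : Matrix (Fin 3) (Fin 3) ℝ)
  simp only [coe_expDiag, Matrix.diagonal_mul_diagonal, h, Real.exp_add]

lemma exists_expDiag (c : diagGroup) : ∃ w hw, c = expDiag w hw := by
  obtain ⟨⟨g, hg⟩, e, he, hge⟩ := c
  change g = Matrix.diagonal e at hge
  subst hge
  refine ⟨fun i => Real.log (e i), ?_, ?_⟩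
  · rw [Matrix.det_diagonal] at hg
    rw [← Real.log_prod fun i _ => (he i).ne', hg, Real.log_one]
  · apply Subtype.ext
    apply Subtype.ext
    rw [coe_expDiag]
    simp only [Real.exp_log (he _)]

variable {U V : Fin 3 → ℝ} {x₀ : LatticeSpace}

/-- An orbit with two independent stabilising elements is compact, with an invariant measure. -/
lemma periodic_orbit (hU : ∑ i, U i = 0) (hV : ∑ i, V i = 0)
    (hspan : ∀ w : Fin 3 → ℝ, ∑ i, w i = 0 → ∃ x y : ℝ, ∀ i, w i = x * U i + y * V i)
    (hUx : expDiag U hU • x₀ = x₀) (hVx : expDiag V hV • x₀ = x₀) :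
    IsCompact (MulAction.orbit diagGroup x₀) ∧ ∃ μ, IsPeriodicMeasure x₀ μ := by
  have hsum : ∀ x y : ℝ, ∑ i, (x * U i + y * V i) = 0 := fun x y => by
    rw [Finset.sum_add_distrib, ← Finset.mul_sum, ← Finset.mul_sum, hU, hV]; ring
  let T : ℝ → ℝ → LatticeSpace := fun y x => expDiag (fun i => x * U i + y * V i) (hsum x y) • x₀
  have hT : ∀ x y w hw, (∀ i, x * U i + y * V i = w i) → T y x = expDiag w hw • x₀ := by
    intro x y w hw h
    obtain rfl : (fun i => x * U i + y * V i) = w := funext h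
    rfl
  have hTc : Continuous fun z : ℝ × ℝ => T z.2 z.1 := by
    have : Continuous fun z : ℝ × ℝ =>
        ((expDiag (fun i => z.1 * U i + z.2 * V i) (hsum z.1 z.2) : diagGroup) : SL3R) := by
      apply Continuous.subtype_mk
      apply Continuous.matrix_diagonal
      fun_prop
    exact LatticeSpace.continuous_smul.comp (this.prodMk continuous_const)
  have hadd : ∀ x y x' y', T (y + y') (x + x') =
      expDiag (fun i => x * U i + y * V i) (hsum x y) • T y' x' := fun x y x' y' => by
    simp only [T]
    rw [smul_smul, expDiag_mul (hsum x y) (hsum x' y') (hsum (x + x') (y + y'))]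
    intro i; ring
  have hT1 : ∀ y, Function.Periodic (T y) 1 := fun y x => by
    have h := hadd x y 1 0
    rw [add_zero] at h
    rw [h]
    have : T 0 1 = x₀ := (hT _ _ _ _ fun i => by ring).trans hUx
    rw [this]
  have hT2 : Function.Periodic (fun y => (hT1 y).lift) 1 := fun y => by
    funext z
    induction z using QuotientAddGroup.induction_on with
    | H x =>
      change T (y + 1) x = T y x
      have h := hadd x y 0 1
      rw [add_zero] at h
      rw [h]
      have : T 1 0 = x₀ := (hT _ _ _ _ fun i => by ring).trans hVx
      rw [this]
  let F : UnitAddCircle × UnitAddCircle → LatticeSpace := fun z => hT2.lift z.2 z.1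
  have hF : ∀ x y : ℝ, F ((x : UnitAddCircle), (y : UnitAddCircle)) = T y x := fun x y => rfl
  have hq : IsOpenQuotientMap (Prod.map (QuotientAddGroup.mk : ℝ → UnitAddCircle)
      (QuotientAddGroup.mk : ℝ → UnitAddCircle)) :=
    QuotientAddGroup.isOpenQuotientMap_mk.prodMap QuotientAddGroup.isOpenQuotientMap_mk
  have hFc : Continuous F := hq.isQuotientMap.continuous_iff.2 hTc
  have horb : Set.range F = MulAction.orbit diagGroup x₀ := by
    ext z
    constructor
    · rintro ⟨y, rfl⟩
      obtain ⟨⟨x, y⟩, rfl⟩ := hq.surjective y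
      exact ⟨_, rfl⟩
    · rintro ⟨g, rfl⟩
      obtain ⟨w, hw, rfl⟩ := exists_expDiag g
      obtain ⟨x, y, hxy⟩ := hspan w hw
      obtain rfl : w = fun i => x * U i + y * V i := funext hxy
      exact ⟨((x : UnitAddCircle), (y : UnitAddCircle)), rfl⟩
  have hcomp : IsCompact (MulAction.orbit diagGroup x₀) := by
    rw [← horb]; exact isCompact_range hFc
  refine ⟨hcomp, Measure.map F ((volume : Measure UnitAddCircle).prod volume), ?_, ⟨?_⟩, ?_⟩
  · have : IsProbabilityMeasure (volume : Measure UnitAddCircle) :=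
      ⟨by rw [AddCircle.measure_univ]; simp⟩
    exact Measure.isProbabilityMeasure_map hFc.aemeasurable
  · intro c s hs
    obtain ⟨w, hw, rfl⟩ := exists_expDiag c
    obtain ⟨x, y, hxy⟩ := hspan w hw
    obtain rfl : w = fun i => x * U i + y * V i := funext hxy
    have hcm : Measurable fun z : LatticeSpace =>
        expDiag (fun i => x * U i + y * V i) hw • z :=
      (LatticeSpace.continuous_smul.comp (continuous_const.prodMk continuous_id)).measurable
    rw [Measure.map_apply hFc.measurable (hcm hs), Measure.map_apply hFc.measurable hs,
      ← measure_preimage_add _ ((x : UnitAddCircle), (y : UnitAddCircle)) (F ⁻¹' s)]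
    congr 1
    ext z
    obtain ⟨⟨x', y'⟩, rfl⟩ := hq.surjective z
    simp only [Set.mem_preimage]
    have : F (((x : UnitAddCircle), (y : UnitAddCircle)) +
        Prod.map QuotientAddGroup.mk QuotientAddGroup.mk (x', y')) = T (y + y') (x + x') := rfl
    rw [this, hadd]
    rfl
  · rw [Measure.map_apply hFc.measurable hcomp.isClosed.isOpen_compl.measurableSet, ← horb]
    convert measure_empty (μ := (volume : Measure UnitAddCircle).prod volume)
    ext z
    simp

end Diag

section OrderPoint

variable {a b c d p q r t : ℤ} {B L : ℝ} {K : Type*} [Field K] {θ : K} {σ σ' : Fin 3 → (K →+* ℝ)}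

lemma OrderData.abs_det_vandermonde (D : OrderData a b c d p q r t B L θ σ)
    (h : Function.Bijective σ') : |(Matrix.vandermonde fun i => σ' i θ).det| =
      |(σ 0 θ - σ 1 θ) * (σ 0 θ - σ 2 θ) * (σ 1 θ - σ 2 θ)| := by
  obtain ⟨π, hπ⟩ := D.exists_perm h
  rw [← Matrix.abs_det_submatrix_equiv_equiv π (Equiv.refl _)]
  have : (Matrix.vandermonde fun i => σ' i θ).submatrix π (Equiv.refl _) =
      Matrix.vandermonde fun i => σ i θ := by
    ext i j
    simp [Matrix.vandermonde_apply, hπ]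
  rw [this, Matrix.det_vandermonde, ← abs_neg]
  congr 1
  simp [Fin.prod_univ_succ, Fin.prod_Ioi_succ]
  ring

/-- The lattice `g ℤ³`. -/
def latticeOf (g : SL3R) : Set (Fin 3 → ℝ) :=
  {v | ∃ n : Fin 3 → ℤ, v = (g : Matrix (Fin 3) (Fin 3) ℝ).mulVec fun i => (n i : ℝ)}

/-- The multiple by `s` of the lattice of the order `ℤ[θ]`. -/
def orderLattice (σ : Fin 3 → (K →+* ℝ)) (θ : K) (s : ℝ) : Set (Fin 3 → ℝ) :=
  {v | ∃ α ∈ zAdjoin θ, v = s • fun i => σ i α}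

lemma OrderData.exists_isOrderPoint (D : OrderData a b c d p q r t B L θ σ) :
    ∃ x, IsOrderPoint (zAdjoin θ) x := by
  set Δ := (Matrix.vandermonde fun i => σ i θ).det with hΔ
  have hΔ0 : Δ ≠ 0 := by
    rw [← abs_pos, hΔ, D.abs_det_vandermonde D.bij]
    exact (Real.exp_pos _).trans_le D.data.disc
  obtain ⟨s, hs, hsΔ⟩ : ∃ s : ℤ, s * s = 1 ∧ (s : ℝ) * Δ = |Δ| := by
    rcases lt_or_gt_of_ne hΔ0 with h | h
    · exact ⟨-1, by norm_num, by rw [abs_of_neg h]; push_cast; ring⟩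
    · exact ⟨1, by norm_num, by rw [abs_of_pos h]; push_cast; ring⟩
  obtain ⟨ρ, hρ, hρ3⟩ : ∃ ρ : ℝ, 0 < ρ ∧ ρ ^ 3 = |Δ|⁻¹ :=
    ⟨|Δ|⁻¹ ^ ((3 : ℕ) : ℝ)⁻¹, by positivity, Real.rpow_inv_natCast_pow (by positivity) (by norm_num)⟩
  set M : Matrix (Fin 3) (Fin 3) ℝ := Matrix.of fun i => ![ρ * s, ρ * σ i θ, ρ * σ i θ ^ 2] with hM
  have hdet : M.det = 1 := by
    have e : M.det = ρ ^ 3 * (s * Δ) := by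
      rw [hΔ, Matrix.det_fin_three, Matrix.det_fin_three]
      simp [hM, Matrix.vandermonde_apply]
      ring
    rw [e, hsΔ, hρ3, inv_mul_cancel₀ (abs_ne_zero.2 hΔ0)]
  have hMn : ∀ n : Fin 3 → ℤ, M.mulVec (fun i => (n i : ℝ)) =
      ρ • fun i => σ i ((s * n 0 : ℤ) + n 1 * θ + n 2 * θ ^ 2) := by
    intro n
    ext i
    simp [hM, Matrix.mulVec, dotProduct, Fin.sum_univ_three]
    ring
  refine ⟨LatticeSpace.mk ⟨M, hdet⟩, σ, ρ, ⟨M, hdet⟩, D.bij, hρ, ?_, rfl⟩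
  ext v
  constructor
  · rintro ⟨n, rfl⟩
    refine ⟨_, ?_, hMn n⟩
    exact add_mem (add_mem (int_mem _) (mul_mem (int_mem _) theta_mem))
      (mul_mem (int_mem _) (pow_mem theta_mem 2))
  · rintro ⟨α, hα, rfl⟩
    obtain ⟨k, m, n, rfl⟩ := D.exists_coeffs hα
    have : s * (s * k) = k := by rw [← mul_assoc, hs, one_mul]
    refine ⟨![s * k, m, n], Eq.trans ?_ (hMn _).symm⟩
    simp [-Int.cast_mul, this]

variable {g : SL3R} {s : ℝ}

lemma mulVec_single_mem (j : Fin 3) :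
    (fun i => (g : Matrix (Fin 3) (Fin 3) ℝ) i j) ∈ latticeOf g := by
  refine ⟨Pi.single j 1, ?_⟩
  ext i
  simp [Matrix.mulVec, dotProduct, Pi.single_apply]

lemma OrderData.scale_le (D : OrderData a b c d p q r t B L θ σ) (h : Function.Bijective σ')
    (hs : 0 < s) (hset : latticeOf g = orderLattice σ' θ s) :
    Real.log s ≤ -(2 / 3 * L) + B / 3 := by
  have hcol : ∀ j, ∃ k : Fin 3 → ℤ, ∀ i, (g : Matrix (Fin 3) (Fin 3) ℝ) i j =
      s * ∑ l : Fin 3, σ' i θ ^ (l : ℕ) * k l := by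
    intro j
    have hm := mulVec_single_mem (g := g) j
    rw [hset] at hm
    obtain ⟨α, hα, e⟩ := hm
    obtain ⟨k, m, n, rfl⟩ := D.exists_coeffs hα
    refine ⟨![k, m, n], fun i => ?_⟩
    have := congrFun e i
    rw [this]
    simp [Fin.sum_univ_three]
    left; ring
  choose A hA using hcol
  have e : (g : Matrix (Fin 3) (Fin 3) ℝ) = s • ((Matrix.vandermonde fun i => σ' i θ) *
      (Int.castRingHom ℝ).mapMatrix (Matrix.of fun l j => A j l)) := by
    ext i j
    rw [hA, Matrix.smul_apply, Matrix.mul_apply, smul_eq_mul]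
    rfl
  have hdet := congrArg Matrix.det e
  rw [Matrix.SpecialLinearGroup.det_coe, Matrix.det_smul, Matrix.det_mul, ← RingHom.map_det,
    eq_intCast, Fintype.card_fin] at hdet
  set N := (Matrix.of fun l j => A j l).det
  have hN : N ≠ 0 := by
    intro h
    rw [h] at hdet
    norm_num at hdet
  have hN1 : (1 : ℝ) ≤ |(N : ℝ)| := by exact_mod_cast Int.one_le_abs hN
  have habs := congrArg abs hdet
  rw [abs_one, abs_mul, abs_mul, D.abs_det_vandermonde h, abs_of_pos (by positivity)] at habs
  have h1 : s ^ 3 * Real.exp (2 * L - B) ≤ 1 := by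
    rw [habs]
    gcongr
    exact D.data.disc.trans (le_mul_of_one_le_right (abs_nonneg _) hN1)
  have h2 := Real.log_le_log (by positivity) h1
  rw [Real.log_mul (by positivity) (Real.exp_ne_zero _), Real.log_exp, Real.log_pow,
    Real.log_one] at h2
  push_cast at h2
  linarith

lemma sum_unitLog_eq_zero (D : OrderData a b c d p q r t B L θ σ) (h : Function.Bijective σ')
    (ε : (zAdjoin θ)ˣ) : ∑ i, unitLog σ' ε i = 0 := by
  obtain ⟨π, hπ⟩ := D.exists_perm h
  rw [sum_logVec_perm hπ (fun x _ => x) ε ε]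
  exact D.sum_unitLog ε

/-- The squares of the units stabilise the lattice of the order. -/
lemma expDiag_smul_eq (hset : latticeOf g = orderLattice σ' θ s) (ε : (zAdjoin θ)ˣ)
    {w : Fin 3 → ℝ} (hw : ∑ i, w i = 0) (hwε : ∀ i, w i = 2 * unitLog σ' ε i) :
    expDiag w hw • LatticeSpace.mk g = LatticeSpace.mk g := by
  rw [LatticeSpace.smul_mk, eq_comm, LatticeSpace.mk_eq_mk, mem_SL3Z_iff]
  intro i j
  have hm := mulVec_single_mem (g := g) j
  rw [hset] at hm
  obtain ⟨α, hα, e⟩ := hm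
  have hexp : ∀ i, Real.exp (w i) = σ' i ((ε : zAdjoin θ) : K) ^ 2 := fun i => by
    have : 0 < |σ' i ((ε : zAdjoin θ) : K)| :=
      abs_pos.2 ((_root_.map_ne_zero _).2 (unit_coe_ne_zero _))
    rw [hwε, unitLog, two_mul, Real.exp_add, Real.exp_log this, abs_mul_abs_self, sq]
  have hmem : (s • fun i => σ' i (((ε : zAdjoin θ) : K) ^ 2 * α)) ∈ latticeOf g := by
    rw [hset]
    exact ⟨_, mul_mem (pow_mem (ε : zAdjoin θ).2 2) hα, rfl⟩
  obtain ⟨n, hn⟩ := hmem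
  refine ⟨n i, ?_⟩
  have h1 : (fun i => (((expDiag w hw : SL3R) * g : SL3R) : Matrix (Fin 3) (Fin 3) ℝ) i j) =
      (g : Matrix (Fin 3) (Fin 3) ℝ).mulVec fun i => (n i : ℝ) := by
    rw [← hn]
    ext k
    rw [Matrix.SpecialLinearGroup.coe_mul, coe_expDiag, Matrix.diagonal_mul, hexp]
    have := congrFun e k
    rw [this]
    simp only [Pi.smul_apply, smul_eq_mul, map_mul, map_pow]
    ring
  have h2 := congrFun (congrArg ((g⁻¹ : SL3R) : Matrix (Fin 3) (Fin 3) ℝ).mulVec h1) i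
  rw [Matrix.mulVec_mulVec, ← Matrix.SpecialLinearGroup.coe_mul, inv_mul_cancel,
    Matrix.SpecialLinearGroup.coe_one, Matrix.one_mulVec] at h2
  rw [← h2, Matrix.SpecialLinearGroup.coe_mul]
  rfl

/-- The units give short vectors unless the translate is far from all of them. -/
lemma exists_le_add_unitLog (hs : 0 < s) (hset : latticeOf g = orderLattice σ' θ s) {M : ℝ}
    (hM : 1 ≤ M) {w : Fin 3 → ℝ} {hw : ∑ i, w i = 0}
    (hthick : expDiag w hw • LatticeSpace.mk g ∈ thickPart M) (ε : (zAdjoin θ)ˣ) :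
    ∃ i, -Real.log (3 * M) - Real.log s ≤ w i + unitLog σ' ε i := by
  have hmem : (s • fun i => σ' i ((ε : zAdjoin θ) : K)) ∈ latticeOf g := by
    rw [hset]
    exact ⟨_, (ε : zAdjoin θ).2, rfl⟩
  obtain ⟨n, hn⟩ := hmem
  have hpos : ∀ i, 0 < |σ' i ((ε : zAdjoin θ) : K)| := fun i =>
    abs_pos.2 ((_root_.map_ne_zero _).2 (unit_coe_ne_zero _))
  have hn0 : n ≠ 0 := by
    rintro rfl
    have := congrFun hn 0
    simp only [Pi.zero_apply, Int.cast_zero, Pi.smul_apply, smul_eq_mul] at this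
    rw [show (fun _ : Fin 3 => (0 : ℝ)) = 0 from rfl, Matrix.mulVec_zero, Pi.zero_apply,
      mul_eq_zero, ← abs_eq_zero (a := σ' 0 _)] at this
    exact this.elim hs.ne' (hpos 0).ne'
  rw [LatticeSpace.smul_mk] at hthick
  obtain ⟨i, hi⟩ := exists_le_of_mem_thickPart hM hthick hn0
  refine ⟨i, ?_⟩
  rw [Matrix.SpecialLinearGroup.coe_mul, ← Matrix.mulVec_mulVec, ← hn, coe_expDiag,
    Matrix.mulVec_diagonal, Pi.smul_apply, smul_eq_mul, abs_mul, abs_mul, abs_of_pos hs,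
    abs_of_pos (Real.exp_pos _)] at hi
  have h2 := Real.log_le_log (by positivity) hi
  rw [Real.log_mul (Real.exp_ne_zero _) (mul_pos hs (hpos i)).ne', Real.log_exp,
    Real.log_mul hs.ne' (hpos i).ne', one_div, Real.log_inv] at h2
  unfold unitLog
  linarith

/-- The orbit of the point of the order is compact and carries an invariant measure. -/
lemma OrderData.periodic (D : OrderData a b c d p q r t B L θ σ) (hL : 2 * B < L)
    {u v : (zAdjoin θ)ˣ} (H : HexApprox B L (unitLog σ u) (unitLog σ v)) {x : LatticeSpace}
    (hx : IsOrderPoint (zAdjoin θ) x) :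
    IsCompact (MulAction.orbit diagGroup x) ∧ ∃ μ, IsPeriodicMeasure x μ := by
  obtain ⟨σ', s, g, hbij, hs, hset, rfl⟩ := hx
  obtain ⟨π, hπ⟩ := D.exists_perm hbij
  have hsum : ∀ ε : (zAdjoin θ)ˣ, ∑ i, 2 * unitLog σ' ε i = 0 := fun ε => by
    rw [← Finset.mul_sum, sum_unitLog_eq_zero D hbij, mul_zero]
  refine periodic_orbit (hsum u) (hsum v) ?_ (expDiag_smul_eq hset u _ fun i => rfl)
    (expDiag_smul_eq hset v _ fun i => rfl)
  intro w hw
  obtain ⟨x, y, hxy⟩ := H.exists_coord hL (fun i => w (π i)) (by rwa [Equiv.sum_comp π])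
  refine ⟨x / 2, y / 2, fun i => ?_⟩
  have := hxy (π.symm i)
  rw [Equiv.apply_symm_apply] at this
  rw [this]
  simp only [unitLog, ← hπ, Equiv.apply_symm_apply]
  ring

lemma int_close_eq {k : ℕ} (hk : 0 < k) {i j : Fin k} {P : ℝ} {m n : ℤ}
    (hm : |P - (i : ℝ) / k + 1 / 3 - m| ≤ 2 * (1 / (10 * k)))
    (hn : |P - (j : ℝ) / k + 1 / 3 - n| ≤ 2 * (1 / (10 * k))) : i = j := by
  have hk0 : (0 : ℝ) < k := by exact_mod_cast hk
  rw [abs_le] at hm hn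
  have e : (2 : ℝ) * (1 / (10 * k)) = 1 / 5 / k := by field_simp; norm_num
  rw [e] at hm hn
  have h1 : ((j : ℝ) - i) / k - (m - n) ≤ 2 / 5 / k := by
    have : ((j : ℝ) - i) / k = j / k - i / k := sub_div _ _ _
    have : (2 : ℝ) / 5 / k = 1 / 5 / k + 1 / 5 / k := by ring
    linarith
  have h2 : -(2 / 5 / k) ≤ ((j : ℝ) - i) / k - (m - n) := by
    have : ((j : ℝ) - i) / k = j / k - i / k := sub_div _ _ _
    have : (2 : ℝ) / 5 / k = 1 / 5 / k + 1 / 5 / k := by ring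
    linarith
  have h3 : ((j : ℝ) - i) - (m - n) * k ≤ 2 / 5 := by
    have := mul_le_mul_of_nonneg_right h1 hk0.le
    rw [sub_mul, div_mul_cancel₀ _ hk0.ne', div_mul_cancel₀ _ hk0.ne'] at this
    exact this
  have h4 : -(2 / 5) ≤ ((j : ℝ) - i) - (m - n) * k := by
    have := mul_le_mul_of_nonneg_right h2 hk0.le
    rw [sub_mul, neg_mul, div_mul_cancel₀ _ hk0.ne', div_mul_cancel₀ _ hk0.ne'] at this
    exact this
  have h5 : ((j : ℤ) - (i : ℤ)) - (m - n) * k = 0 := by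
    have a1 : (((((j : ℕ) : ℤ) - ((i : ℕ) : ℤ)) - (m - n) * (k : ℤ) : ℤ) : ℝ) < ((1 : ℤ) : ℝ) := by
      push_cast; linarith
    have a2 : (((-1 : ℤ)) : ℝ) < (((((j : ℕ) : ℤ) - ((i : ℕ) : ℤ)) - (m - n) * (k : ℤ) : ℤ) : ℝ) := by
      push_cast; linarith
    have := Int.cast_lt.1 a1
    have := Int.cast_lt.1 a2
    omega
  have hi := i.2
  have hj := j.2
  have h6 : ((j : ℕ) : ℤ) - ((i : ℕ) : ℤ) = 0 := by
    apply Int.eq_zero_of_abs_lt_dvd (m := (k : ℤ))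
    · exact ⟨m - n, by linarith⟩
    · rw [abs_lt]; constructor <;> omega
  apply Fin.ext
  omega

/-- Little of an invariant measure on the orbit lies in the thick part. -/
lemma OrderData.measure_thickPart (D : OrderData a b c d p q r t B L θ σ)
    {u v : (zAdjoin θ)ˣ} (H : HexApprox B L (unitLog σ u) (unitLog σ v)) {x : LatticeSpace}
    (hx : IsOrderPoint (zAdjoin θ) x) {μ : Measure LatticeSpace} (hμ : IsPeriodicMeasure x μ)
    {M : ℝ} (hM : 1 ≤ M) {k : ℕ} (hk : 0 < k) (hL : 2 * B < L)
    (hLk : (Real.log (3 * M) + B / 3) + 4 * B ≤ 1 / (10 * k) * L) :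
    k * μ.real (thickPart M) ≤ 1 := by
  obtain ⟨hprob, hinv, hsupp⟩ := hμ
  obtain ⟨σ', s, g, hbij, hs, hset, rfl⟩ := hx
  obtain ⟨π, hπ⟩ := D.exists_perm hbij
  have hB := H.nonneg
  have hk0 : (0 : ℝ) < k := by exact_mod_cast hk
  have hk1 : (1 : ℝ) ≤ k := by exact_mod_cast hk
  have hscale := D.scale_le hbij hs hset
  have hsum : ∀ x : ℝ, ∑ i, x * unitLog σ' u i = 0 := fun x => by
    rw [← Finset.mul_sum, sum_unitLog_eq_zero D hbij, mul_zero]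
  set A : Fin k → diagGroup := fun j => expDiag _ (hsum ((j : ℝ) / k)) with hA
  set S : Fin k → Set LatticeSpace := fun j => (fun y => A j • y) ⁻¹' thickPart M with hS
  have hopen : ∀ j, IsOpen (S j) := fun j => (isOpen_thickPart M).preimage
    (LatticeSpace.continuous_smul.comp (continuous_const.prodMk continuous_id))
  have hdisj : Pairwise (Function.onFun (AEDisjoint μ) S) := by
    intro i j hij
    refine measure_mono_null ?_ hsupp
    rintro y ⟨hyi, hyj⟩ ⟨e, rfl⟩
    apply hij
    obtain ⟨w, hw, rfl⟩ := exists_expDiag e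
    obtain ⟨P, Q, hPQ⟩ := H.exists_coord hL (fun i => w (π i)) (by rwa [Equiv.sum_comp π])
    have near : ∀ l : Fin k, expDiag w hw • LatticeSpace.mk g ∈ S l →
        ∃ n : ℤ, |-P - (l : ℝ) / k + 1 / 3 - n| ≤ 2 * (1 / (10 * k)) := by
      intro l hl
      have hsum' : ∑ i, ((l : ℝ) / k * unitLog σ' u i + w i) = 0 := by
        rw [Finset.sum_add_distrib, hsum, hw, add_zero]
      have hl' : expDiag _ hsum' • LatticeSpace.mk g ∈ thickPart M := by
        rw [← expDiag_mul (hsum ((l : ℝ) / k)) hw hsum' fun i => rfl, ← smul_smul]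
        exact hl
      refine H.near_hole (by linarith) (Q := -Q) (D := Real.log (3 * M) + B / 3) ?_ hLk ?_
      · rw [div_le_div_iff₀ (by positivity) (by norm_num)]
        linarith
      · intro m n
        obtain ⟨i, hi⟩ := exists_le_add_unitLog hs hset hM hl' (u ^ m * v ^ n)
        refine ⟨π.symm i, ?_⟩
        have h1 := hPQ (π.symm i)
        simp only [Equiv.apply_symm_apply] at h1
        have h2 : ∀ ε : (zAdjoin θ)ˣ, unitLog σ ε (π.symm i) = unitLog σ' ε i := fun ε => by
          simp only [unitLog, ← hπ, Equiv.apply_symm_apply]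
        rw [unitLog_mul, unitLog_zpow, unitLog_zpow, h1, h2, h2] at hi
        rw [h2, h2]
        have e : (m - (-P - (l : ℝ) / k)) * unitLog σ' u i + (n - -Q) * unitLog σ' v i =
          (l : ℝ) / k * unitLog σ' u i + (P * unitLog σ' u i + Q * unitLog σ' v i) +
            (m * unitLog σ' u i + n * unitLog σ' v i) := by ring
        rw [e]
        linarith
    obtain ⟨n₁, h₁⟩ := near i hyi
    obtain ⟨n₂, h₂⟩ := near j hyj
    exact int_close_eq hk h₁ h₂
  have hmeas : ∀ j, μ (S j) = μ (thickPart M) := fun j => measure_preimage_smul μ (A j) _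
  have hU := measure_iUnion₀ hdisj fun j => (hopen j).measurableSet.nullMeasurableSet
  rw [tsum_fintype] at hU
  simp only [hmeas, Finset.sum_const, Finset.card_univ, Fintype.card_fin, nsmul_eq_mul] at hU
  have h1 : (k : ENNReal) * μ (thickPart M) ≤ 1 := by
    rw [← hU]; exact prob_le_one
  have h2 := ENNReal.toReal_mono ENNReal.one_ne_top h1
  rw [ENNReal.toReal_mul, ENNReal.toReal_natCast, ENNReal.toReal_one] at h2
  exact h2

end OrderPoint

section Final

variable {a b c d p q r : ℤ} {h : ℤ[X]}

/-- The data of the order `ℤ[θ]`, with the units `a θ - b` and `c θ - d`. -/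
def HasUnits (a b c d p q r t : ℤ) (B L : ℝ) {K : Type*} [Field K] (θ : K) : Prop :=
  ∃ (σ : Fin 3 → (K →+* ℝ)) (u v : (zAdjoin θ)ˣ), OrderData a b c d p q r t B L θ σ ∧
    ((u : zAdjoin θ) : K) = a * θ - b ∧ ((v : zAdjoin θ) : K) = c * θ - d

lemma cross_ne_zero (ha : a ≠ 0) (hc : c ≠ 0) (hbd : (b : ℚ) / a ≠ (d : ℚ) / c) :
    c * b - a * d ≠ 0 := by
  intro h
  apply hbd
  rw [div_eq_div_iff (by exact_mod_cast ha) (by exact_mod_cast hc)]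
  have : ((c * b - a * d : ℤ) : ℚ) = 0 := by rw [h, Int.cast_zero]
  push_cast at this
  linarith

lemma eventually_hasUnits (hh : h = X ^ 3 + C p * X ^ 2 + C q * X + C r)
    (h₁ : |b ^ 3 + p * a * b ^ 2 + q * a ^ 2 * b + r * a ^ 3| = 1)
    (h₂ : |d ^ 3 + p * c * d ^ 2 + q * c ^ 2 * d + r * c ^ 3| = 1) {B : ℝ}
    (hroots : ∀ᶠ t : ℤ in absAtTop, ∃ x, RootData a b c d p q r B (Real.log |(t : ℝ)|) t x)
    (hirr : ∀ᶠ t in absAtTop, Irreducible (family a b c d h t))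
    (K : ℤ → Type*) [∀ t, Field (K t)] [∀ t, NumberField (K t)] (θ : ∀ t, K t)
    (hθ : ∀ t, aeval (θ t) (family a b c d h t) = 0)
    (htop : ∀ t, IntermediateField.adjoin ℚ {θ t} = ⊤) :
    ∀ᶠ t : ℤ in absAtTop, HasUnits a b c d p q r t B (Real.log |(t : ℝ)|) (θ t) := by
  filter_upwards [hroots, hirr] with t ⟨x, hx⟩ ht
  obtain ⟨σ, hσ⟩ := exists_orderData hx hh ht (hθ t) (htop t)
  obtain ⟨u, hu⟩ := exists_unit hσ.root h₁
  obtain ⟨v, hv⟩ := exists_unit (a := c) (b := d) (c := a) (d := b)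
    (by rw [mul_comm (c * θ t - d : K t)]; exact hσ.root) h₂
  exact ⟨σ, u, v, hσ, hu, hv⟩

lemma fullEscapeOfMass_of_thickPart {ι : Type*} {l : Filter ι} {μ : ι → Measure LatticeSpace}
    (h : ∀ (M : ℝ) (k : ℕ), 1 ≤ M → 0 < k →
      ∀ᶠ i in l, IsProbabilityMeasure (μ i) ∧ k * (μ i).real (thickPart M) ≤ 1) :
    FullEscapeOfMass l μ := by
  intro f hf hsupp
  obtain ⟨A, hA⟩ := hsupp.exists_bound_of_continuous hf
  obtain ⟨M, hM, hsub⟩ := exists_subset_thickPart hsupp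
  rw [Metric.tendsto_nhds]
  intro ε hε
  obtain ⟨k, hk⟩ := exists_nat_gt (|A| / ε)
  have hk0 : (0 : ℝ) < k := lt_of_le_of_lt (by positivity) hk
  filter_upwards [h M k hM (by exact_mod_cast hk0)] with i ⟨hprob, hi⟩
  rw [dist_zero_right, ← setIntegral_eq_integral_of_forall_compl_eq_zero (s := thickPart M)
    fun x hx => image_eq_zero_of_notMem_tsupport fun hx' => hx (hsub hx')]
  calc ‖∫ x in thickPart M, f x ∂μ i‖ ≤ |A| * (μ i).real (thickPart M) :=
        norm_setIntegral_le_of_norm_le_const (measure_lt_top _ _)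
          fun x _ => (hA x).trans (le_abs_self A)
    _ ≤ |A| * (1 / k) := by
        gcongr
        rw [le_div_iff₀' hk0]
        exact hi
    _ < ε := by
        rw [mul_one_div, div_lt_iff₀ hk0]
        rwa [div_lt_iff₀' hε] at hk

end Final

end CubicOrders

open CubicOrders in
theorem theorem1p2 (a b c d : ℤ) (ha : a ≠ 0) (hc : c ≠ 0)
    (hbd : (b : ℚ) / a ≠ (d : ℚ) / c) (hac : a ≠ c) (hac' : a ≠ -c)
    (h : ℤ[X]) (hmonic : h.Monic) (hdeg : h.natDegree = 3)
    (h₁ : (a : ℚ) ^ 3 * aeval ((b : ℚ) / a) h = 1 ∨ (a : ℚ) ^ 3 * aeval ((b : ℚ) / a) h = -1)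
    (h₂ : (c : ℚ) ^ 3 * aeval ((d : ℚ) / c) h = 1 ∨ (c : ℚ) ^ 3 * aeval ((d : ℚ) / c) h = -1) :
    -- for `|t|` large, `h_t` is totally real and irreducible
    (∀ᶠ t in absAtTop, IsTotallyReal (family a b c d h t) ∧ Irreducible (family a b c d h t)) ∧
    -- for every choice of roots `θ_t` of `h_t`, with `K_t = ℚ(θ_t)`
    ∀ (K : ℤ → Type*) [∀ t, Field (K t)] [∀ t, NumberField (K t)] (θ : ∀ t, K t),
      (∀ t, aeval (θ t) (family a b c d h t) = 0) →
      (∀ t, IntermediateField.adjoin ℚ {θ t} = ⊤) →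
      -- for `|t|` large, `a θ_t - b`, `c θ_t - d` and `-1` generate the unit group of `ℤ[θ_t]`
      (∀ᶠ t in absAtTop, ∃ u v : (zAdjoin (θ t))ˣ,
        ((u : zAdjoin (θ t)) : K t) = a * θ t - b ∧ ((v : zAdjoin (θ t)) : K t) = c * θ t - d ∧
        Subgroup.closure {u, v, -1} = ⊤) ∧
      -- the unit lattices have shapes, which converge to the regular triangle lattice
      ((∀ᶠ t in absAtTop, ∃ s, IsUnitShape (zAdjoin (θ t)) s) ∧
        ∀ s : ℤ → ModularSurface, (∀ᶠ t in absAtTop, IsUnitShape (zAdjoin (θ t)) (s t)) →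
          Tendsto s absAtTop (𝓝 triangleShape)) ∧
      -- the orders have compact `A`-orbits, which exhibit full escape of mass
      ((∀ᶠ t in absAtTop, ∃ x, IsOrderPoint (zAdjoin (θ t)) x) ∧
        ∀ x : ℤ → LatticeSpace, (∀ᶠ t in absAtTop, IsOrderPoint (zAdjoin (θ t)) (x t)) →
          (∀ᶠ t in absAtTop, IsCompact (MulAction.orbit diagGroup (x t)) ∧
            ∃ μ, IsPeriodicMeasure (x t) μ) ∧
          ∀ μ : ℤ → Measure LatticeSpace, (∀ᶠ t in absAtTop, IsPeriodicMeasure (x t) (μ t)) →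
            FullEscapeOfMass absAtTop μ) := by
  obtain ⟨p, q, r, hh⟩ := exists_cubic_coeffs hmonic hdeg
  have n₁ := hom_form_of_aeval ha hh h₁
  have n₂ := hom_form_of_aeval hc hh h₂
  have hirr := family_irreducible (c := c) (d := d) ha hh n₁ n₂
  obtain ⟨B, hroots⟩ : ∃ B : ℝ, ∀ᶠ t : ℤ in absAtTop,
      ∃ x, RootData a b c d p q r B (Real.log |(t : ℝ)|) t x := by
    obtain ⟨B, N, H⟩ := exists_rootData a b c d p q r ha hc (cross_ne_zero ha hc hbd) n₁ n₂
    exact ⟨B, eventually_absAtTop.2 ⟨N, fun t ht => H t ht⟩⟩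
  refine ⟨?_, fun K _ _ θ hθ htop => ?_⟩
  · filter_upwards [hroots, hirr] with t ⟨x, hx⟩ ht
    exact ⟨hx.isTotallyReal hh, ht⟩
  have hunits := eventually_hasUnits hh n₁ n₂ hroots hirr K θ hθ htop
  have hlarge := eventually_le_log (8 * B + 2 * Real.log 8 + 1)
  have h8 : 0 < Real.log 8 := Real.log_pos (by norm_num)
  refine ⟨?_, ⟨?_, fun s hs => tendsto_triangleShape fun ε hε => ?_⟩, ?_, fun x hx =>
    ⟨?_, fun μ hμ => fullEscapeOfMass_of_thickPart fun M k hM hk => ?_⟩⟩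
  · filter_upwards [hunits, hlarge] with t ⟨σ, u, v, D, hu, hv⟩ hL
    exact ⟨u, v, hu, hv, closure_eq_top (D.exists_zpow (by linarith) hu hv)⟩
  · filter_upwards [hunits, hlarge] with t ⟨σ, u, v, D, hu, hv⟩ hL
    have H := D.hexApprox hu hv
    have hB := H.nonneg
    exact D.exists_isUnitShape (by linarith) H (D.exists_zpow (by linarith) hu hv)
  · filter_upwards [hunits, hlarge, hs, eventually_le_log
      (8 * B + 12 * B ^ 2 + 2 * (8 * B + 12 * B ^ 2) / ε)] with t ⟨σ, u, v, D, hu, hv⟩ hL hst hLε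
    have H := D.hexApprox hu hv
    have hB := H.nonneg
    exact D.isUnitShape_near (by linarith) H (D.exists_zpow (by linarith) hu hv) hε (by linarith)
      (by linarith) hst
  · filter_upwards [hunits] with t ⟨σ, u, v, D, hu, hv⟩
    exact D.exists_isOrderPoint
  · filter_upwards [hunits, hlarge, hx] with t ⟨σ, u, v, D, hu, hv⟩ hL hxt
    have H := D.hexApprox hu hv
    have hB := H.nonneg
    exact D.periodic (by linarith) H hxt
  · filter_upwards [hunits, hlarge, hx, hμ, eventually_le_log
      (10 * k * ((Real.log (3 * M) + B / 3) + 4 * B))] with t ⟨σ, u, v, D, hu, hv⟩ hL hxt hμt hLk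
    have H := D.hexApprox hu hv
    have hB := H.nonneg
    have hk0 : (0 : ℝ) < k := by exact_mod_cast hk
    refine ⟨hμt.1, D.measure_thickPart H hxt hμt hM hk (by linarith) ?_⟩
    rw [one_div, ← div_eq_inv_mul, le_div_iff₀ (by positivity)]
    linarith
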